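/- **($r$-fold Kadell formula.)** Let $r\ge 1$, $0\le a<r$ and $N\ge 0$ be integers, and let $u,v\in\mathbb{C}$ with $\operatorname{Re}u>-1/r$, $\operatorname{Re}v>-1$. Put $\omega=e^{2\pi i/r}$, let $B_j$ be the segment from $0$ to $\omega^j$, and let $C_{r,a}=\sum_{j=0}^{r-1}\omega^{-ja}B_j$ (a formal linear combination of contours). For a symmetric polynomial $\mathcal O$ in $x_1,\dots,x_N$ set $$Z[\mathcal O]=\frac1{N!}\int_{C_{r,a}^N}\prod_{i=1}^N\frac{dx_i}{2\pi}\,\mathcal O(x)\prod_{i<j}(x_i-x_j)^2\prod_{i=1}^N (x_i^r)^u(1-x_i^r)^v,\qquad Z=Z[1],\qquad \langle\mathcal O\rangle=\frac{Z[\mathcal O]}{Z}.$$ Let $\lambda=(\lambda_1\ge\dots\ge\lambda_N\ge0)$ be a partition with at most $N$ parts and $s_\lambda(x)=\det(x_i^{N+\lambda_j-j})/\det(x_i^{N-j})$ its Schur polynomial. For a box $x=(i,j)\in\lambda$ (row $i$, column $j$) let $c_\lambda(x)=j-i$ and $h_\lambda(x)=\lambda_i+\lambda^\top_j-i-j+1$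 be its content and hook length. Put $$\llbracket n;y\rrbracket_{r,a}=\begin{cases}n+y & n\equiv a \pmod r\\ 1&\text{otherwise}\end{cases},\qquad \llbracket n\rrbracket_{r,a}=\llbracket n;0\rrbracket_{r,a},$$ $$\delta_r(\lambda)=\begin{cases}(-1)^{|\lambda|/r}\prod_{x\in\lambda}(-1)^{\lfloor c_\lambda(x)/r\rfloor+\lfloor h_\lambda(x)/r\rfloor}&\text{if the } r\text{-core of }\lambda\text{ is empty}\\0&\text{otherwise}\end{cases}$$ where the $r$-core of $\lambda$ is the result of successively stripping rim hooks of length $r$ from $\lambda$ until none is left. Then the integrals defining $Z$ and $Z[s_\lambda]$ converge absolutely; $Z\ne0$ if and only if $N\equiv 0$ or $N\equiv a\pmod r$; and whenever $Z\neq 0$, $$\langle s_\lambda\rangle=\delta_r(\lambda)\prod_{x\in\lambda}\frac{\llbracket N+c_\lambda(x)\rrbracket_{r,0}\,\llbracket N+c_\lambda(x);ru\rrbracket_{r,a}}{\llbracket h_\lambda(x)\rrbracket_{r,0}\,\llbracket 2N+c_\lambda(x);ru+rv\rrbracket_{r,a}}.$$ For $r=1$ this is Kadell's formula for the Schur average in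 the Selberg measure. -/

import Mathlib

noncomputable section

namespace RFold

open MeasureTheory

/-! ### Combinatorics of Young diagrams (cells are `(row, column)`, counted from `0`) -/

/-- The content (column minus row) of a cell. -/
def content (x : ℕ × ℕ) : ℤ := (x.2 : ℤ) - (x.1 : ℤ)

/-- The hook length of a cell `x ∈ lam`: with rows and columns counted from `1` it is
`lam_i + lam^T_j - i - j + 1`. -/
def hookLength (lam : YoungDiagram) (x : ℕ × ℕ) : ℤ :=
  (lam.rowLen x.1 : ℤ) + (lam.colLen x.2 : ℤ) - (x.1 : ℤ) - (x.2 : ℤ) - 1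

/-- The rim hook of `lam` associated with the cell `x`: the cells of the rim of `lam` (those with
no cell of `lam` diagonally below and to the right) that lie weakly below and weakly to the right
of `x`. It has as many cells as the hook of `x`. -/
def rimHook (lam : YoungDiagram) (x : ℕ × ℕ) : Finset (ℕ × ℕ) :=
  lam.cells.filter fun y => x.1 ≤ y.1 ∧ x.2 ≤ y.2 ∧ (y.1 + 1, y.2 + 1) ∉ lam

/-- `mu` arises from `lam` by stripping one rim hook of length `r`. -/
def StripsRimHook (r : ℕ) (lam mu : YoungDiagram) : Prop :=
  ∃ x ∈ lam, hookLength lam x = (r : ℤ) ∧ mu.cells = lam.cells \ rimHook lam x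

/-- `kappa` is the `r`-core of `lam`: it arises from `lam` by successively stripping rim hooks of
length `r`, and no further such rim hook can be stripped from it. -/
def IsRCore (r : ℕ) (lam kappa : YoungDiagram) : Prop :=
  Relation.ReflTransGen (StripsRimHook r) lam kappa ∧ ∀ mu, ¬ StripsRimHook r kappa mu

open Classical in
/-- The `r`-signature of `lam`, which is `0`, `1` or `-1` (integer division rounds down). -/
def rSignature (r : ℕ) (lam : YoungDiagram) : ℤ :=
  if IsRCore r lam ⊥ then
    (((-1 : ℤˣ) ^ (lam.card / r) *
      ∏ x ∈ lam.cells, (-1 : ℤˣ) ^ (content x / (r : ℤ) + hookLength lam x / (r : ℤ)) : ℤˣ) : ℤ)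
  else 0

/-- The deformed residue-selective bracket `⟦n; x⟧_{r,a}`, equal to `n + x` if `n ≡ a (mod r)` and
to `1` otherwise. The undeformed bracket `⟦n⟧_{r,a}` is `⟦n; 0⟧_{r,a}`. -/
def bracket (r a : ℕ) (n : ℤ) (x : ℂ) : ℂ :=
  if n ≡ (a : ℤ) [ZMOD (r : ℤ)] then (n : ℂ) + x else 1

/-- The Schur polynomial `s_lam(x_1, …, x_N)` of a partition with at most `N` parts, as a quotient
of alternants. It is only ever multiplied by the square of the denominator below, so its value at
points with coinciding coordinates is irrelevant. -/
def schur (N : ℕ) (lam : YoungDiagram) (x : Fin N → ℂ) : ℂ :=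
  Matrix.det (Matrix.of fun i j : Fin N => x i ^ (N - 1 - (j : ℕ) + lam.rowLen (j : ℕ))) /
    Matrix.det (Matrix.of fun i j : Fin N => x i ^ (N - 1 - (j : ℕ)))

/-! ### The `r`-fold logarithmic eigenvalue model -/

/-- The root of unity `exp (2 π i / r)`. -/
def omega (r : ℕ) : ℂ := Complex.exp (2 * (Real.pi : ℂ) * Complex.I / (r : ℂ))

/-- The point of the product of segments `[0, ω ^ j_1] × ⋯ × [0, ω ^ j_N]` with parameters
`t ∈ [0, 1] ^ N`. -/
def segPoint (r N : ℕ) (j : Fin N → Fin r) (t : Fin N → ℝ) : Fin N → ℂ :=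
  fun i => omega r ^ (j i : ℕ) * (t i : ℂ)

/-- The density of the model (without `dx_i`) times an insertion `O`. -/
def density (r N : ℕ) (u v : ℂ) (O : (Fin N → ℂ) → ℂ) (x : Fin N → ℂ) : ℂ :=
  O x * (∏ _i : Fin N, (1 / (2 * (Real.pi : ℂ)))) *
    (∏ i : Fin N, ∏ k ∈ Finset.univ.filter (fun k => i < k), (x i - x k) ^ 2) *
    ∏ i : Fin N, ((x i ^ r) ^ u * (1 - x i ^ r) ^ v)

/-- The unit cube `[0, 1] ^ N`. -/
def cube (N : ℕ) : Set (Fin N → ℝ) := Set.pi Set.univ fun _ => Set.Icc (0 : ℝ) 1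

/-- The contour integral of `f(x) dx_1 ⋯ dx_N` over `[0, ω ^ j_1] × ⋯ × [0, ω ^ j_N]`,
parametrized by `x_i = ω ^ j_i * t_i`. -/
def segIntegral (r N : ℕ) (j : Fin N → Fin r) (f : (Fin N → ℂ) → ℂ) : ℂ :=
  ∫ t in cube N, f (segPoint r N j t) * ∏ i : Fin N, omega r ^ (j i : ℕ)

/-- The integral of `f(x) dx_1 ⋯ dx_N` over `C_{r,a} ^ N`, where `C_{r,a}` is the chain
`∑_{j < r} ω ^ (- j a) [0, ω ^ j]`. -/
def contourIntegral (r a N : ℕ) (f : (Fin N → ℂ) → ℂ) : ℂ :=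
  ∑ j : Fin N → Fin r, (∏ i : Fin N, (omega r ^ ((j i : ℕ) * a))⁻¹) * segIntegral r N j f

/-- The unnormalized insertion `Z[O]` in the model of rank `N`. -/
def Z (r a N : ℕ) (u v : ℂ) (O : (Fin N → ℂ) → ℂ) : ℂ :=
  1 / (N.factorial : ℂ) * contourIntegral r a N (density r N u v O)

/-- All the integrals that make up `Z[O]` converge absolutely. -/
def Converges (r N : ℕ) (u v : ℂ) (O : (Fin N → ℂ) → ℂ) : Prop :=
  ∀ j : Fin N → Fin r,
    IntegrableOn (fun t => density r N u v O (segPoint r N j t)) (cube N) volume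

/-- The partition function. -/
def partitionFunction (r a N : ℕ) (u v : ℂ) : ℂ := Z r a N u v fun _ => 1

/-- The normalized average `⟨O⟩ = Z[O] / Z`. -/
def average (r a N : ℕ) (u v : ℂ) (O : (Fin N → ℂ) → ℂ) : ℂ :=
  Z r a N u v O / partitionFunction r a N u v

end RFold

end

noncomputable section

namespace RFold

section Andreief

open MeasureTheory

/-- The one-variable density of the model on the `s`-th segment, times the monomial `x ^ n`. -/
def segDensity (r : ℕ) (u v : ℂ) (s : Fin r) (n : ℕ) (t : ℝ) : ℂ :=
  1 / (2 * (Real.pi : ℂ)) * (omega r ^ (s : ℕ) * (t : ℂ)) ^ n *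
    (((omega r ^ (s : ℕ) * (t : ℂ)) ^ r) ^ u * (1 - (omega r ^ (s : ℕ) * (t : ℂ)) ^ r) ^ v) *
    omega r ^ (s : ℕ)

/-- The moments of the one-variable model. -/
def moment (r a : ℕ) (u v : ℂ) (n : ℕ) : ℂ :=
  ∑ s : Fin r, (omega r ^ ((s : ℕ) * a))⁻¹ * ∫ t in Set.Icc (0 : ℝ) 1, segDensity r u v s n t

lemma omega_isPrimitiveRoot {r : ℕ} (hr : 0 < r) : IsPrimitiveRoot (omega r) r :=
  Complex.isPrimitiveRoot_exp r hr.ne'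

/-- The pull-back of the Beta integrand under `t ↦ t ^ r`. -/
lemma power_mul_beta_integrand {r : ℕ} (hr : 0 < r) (u v : ℂ) (n : ℕ) {t : ℝ} (ht : 0 < t) :
    (t : ℂ) ^ n * (((t : ℂ) ^ r) ^ u * (1 - (t : ℂ) ^ r) ^ v) =
      (1 / (r : ℂ)) * (|(r : ℝ) * t ^ (r - 1)| •
        (((t ^ r : ℝ) : ℂ) ^ (((n : ℂ) + 1) / r + u - 1) *
          (1 - ((t ^ r : ℝ) : ℂ)) ^ (v + 1 - 1))) := by
  have hr0 : (r : ℂ) ≠ 0 := by exact_mod_cast hr.ne'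
  have htc : ((t ^ r : ℝ) : ℂ) ≠ 0 := by exact_mod_cast (pow_pos ht r).ne'
  rw [abs_of_pos (by positivity), Complex.real_smul]
  have e : ((n : ℂ) + 1) / r + u - 1 = (((n : ℝ) + 1) / r - 1 : ℝ) + u := by push_cast; ring
  have h2 : (t ^ r) ^ (((n : ℝ) + 1) / r - 1) = t ^ ((n : ℝ) + 1 - r) := by
    rw [← Real.rpow_natCast, ← Real.rpow_mul ht.le]
    congr 1
    have : (r : ℝ) ≠ 0 := by exact_mod_cast hr.ne'
    field_simp
  have h3 : t ^ (r - 1) * t ^ ((n : ℝ) + 1 - r) = t ^ n := by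
    rw [← Real.rpow_natCast, ← Real.rpow_natCast, ← Real.rpow_add ht]
    congr 1
    rw [Nat.cast_sub hr]; push_cast; ring
  rw [e, Complex.cpow_add _ _ htc, ← Complex.ofReal_cpow (pow_pos ht r).le, h2, add_sub_cancel_right,
    ← Complex.ofReal_pow t n, ← h3]
  push_cast
  field_simp

lemma image_pow_Ioo {r : ℕ} (hr : 0 < r) :
    (fun t : ℝ => t ^ r) '' Set.Ioo 0 1 = Set.Ioo 0 1 := by
  ext y
  constructor
  · rintro ⟨t, ⟨h0, h1⟩, rfl⟩
    exact ⟨pow_pos h0 r, pow_lt_one₀ h0.le h1 hr.ne'⟩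
  · rintro ⟨h0, h1⟩
    refine ⟨y ^ ((r : ℝ)⁻¹), ⟨by positivity, Real.rpow_lt_one h0.le h1 (by positivity)⟩, ?_⟩
    exact Real.rpow_inv_natCast_pow h0.le hr.ne'

lemma radial_integral {r : ℕ} (hr : 0 < r) (u v : ℂ)
    (hu : -1 / (r : ℝ) < u.re) (hv : -1 < v.re) (n : ℕ) :
    IntegrableOn (fun t : ℝ => (t : ℂ) ^ n * (((t : ℂ) ^ r) ^ u * (1 - (t : ℂ) ^ r) ^ v))
      (Set.Icc 0 1) ∧
    ∫ t in Set.Icc (0 : ℝ) 1, (t : ℂ) ^ n * (((t : ℂ) ^ r) ^ u * (1 - (t : ℂ) ^ r) ^ v) =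
      (1 / (r : ℂ)) * Complex.betaIntegral (((n : ℂ) + 1) / r + u) (v + 1) := by
  have hrp : (0 : ℝ) < r := by exact_mod_cast hr
  have hre : 0 < (((n : ℂ) + 1) / r + u).re := by
    have : (((n : ℂ) + 1) / r + u).re = ((n : ℝ) + 1) / r + u.re := by
      rw [Complex.add_re, Complex.div_natCast_re]; simp
    rw [this]
    have : (1 : ℝ) / r ≤ ((n : ℝ) + 1) / r := by gcongr; simp
    rw [neg_div] at hu
    linarith
  have hve : 0 < (v + 1).re := by simp; linarith
  have hconv := Complex.betaIntegral_convergent hre hve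
  rw [intervalIntegrable_iff_integrableOn_Ioo_of_le zero_le_one] at hconv
  have hd : ∀ t ∈ Set.Ioo (0 : ℝ) 1, HasDerivWithinAt (fun t : ℝ => t ^ r)
      ((r : ℝ) * t ^ (r - 1)) (Set.Ioo 0 1) t := fun t _ => (hasDerivAt_pow r t).hasDerivWithinAt
  have hinj : Set.InjOn (fun t : ℝ => t ^ r) (Set.Ioo 0 1) := fun x hx y hy h =>
    (pow_left_inj₀ hx.1.le hy.1.le hr.ne').1 h
  have hcongr : Set.EqOn
      (fun t : ℝ => (t : ℂ) ^ n * (((t : ℂ) ^ r) ^ u * (1 - (t : ℂ) ^ r) ^ v))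
      (fun t : ℝ => (1 / (r : ℂ)) * (|(r : ℝ) * t ^ (r - 1)| •
        (((t ^ r : ℝ) : ℂ) ^ (((n : ℂ) + 1) / r + u - 1) *
          (1 - ((t ^ r : ℝ) : ℂ)) ^ (v + 1 - 1)))) (Set.Ioo 0 1) :=
    fun t ht => power_mul_beta_integrand hr u v n ht.1
  rw [integrableOn_Icc_iff_integrableOn_Ioo, integral_Icc_eq_integral_Ioo]
  constructor
  · rw [integrableOn_congr_fun hcongr measurableSet_Ioo]
    refine Integrable.const_mul ?_ _
    have := (integrableOn_image_iff_integrableOn_abs_deriv_smul measurableSet_Ioo hd hinj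
      (fun s : ℝ => (s : ℂ) ^ (((n : ℂ) + 1) / r + u - 1) * (1 - (s : ℂ)) ^ (v + 1 - 1))).1
      (by rw [image_pow_Ioo hr]; exact hconv)
    exact this
  · rw [setIntegral_congr_fun measurableSet_Ioo hcongr, integral_const_mul]
    congr 1
    have := integral_image_eq_integral_abs_deriv_smul measurableSet_Ioo hd hinj
      (fun s : ℝ => (s : ℂ) ^ (((n : ℂ) + 1) / r + u - 1) * (1 - (s : ℂ)) ^ (v + 1 - 1))
    rw [image_pow_Ioo hr] at this
    rw [← this, Complex.betaIntegral, intervalIntegral.integral_of_le zero_le_one,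
      integral_Ioc_eq_integral_Ioo]

lemma segDensity_eq {r : ℕ} (hr : 0 < r) (u v : ℂ) (s : Fin r) (n : ℕ) (t : ℝ) :
    segDensity r u v s n t = (1 / (2 * (Real.pi : ℂ)) * omega r ^ ((s : ℕ) * (n + 1))) *
      ((t : ℂ) ^ n * (((t : ℂ) ^ r) ^ u * (1 - (t : ℂ) ^ r) ^ v)) := by
  have h : (omega r ^ (s : ℕ) * (t : ℂ)) ^ r = (t : ℂ) ^ r := by
    rw [mul_pow, ← pow_mul, mul_comm (s : ℕ) r, pow_mul, (omega_isPrimitiveRoot hr).pow_eq_one,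
      one_pow, one_mul]
  rw [segDensity, h, mul_pow, ← pow_mul, mul_add, pow_add, mul_one]
  ring

lemma segDensity_integrableOn {r : ℕ} (hr : 0 < r) (u v : ℂ)
    (hu : -1 / (r : ℝ) < u.re) (hv : -1 < v.re) (s : Fin r) (n : ℕ) :
    IntegrableOn (segDensity r u v s n) (Set.Icc 0 1) := by
  have : segDensity r u v s n = fun t : ℝ => (1 / (2 * (Real.pi : ℂ)) * omega r ^ ((s : ℕ) * (n + 1))) *
      ((t : ℂ) ^ n * (((t : ℂ) ^ r) ^ u * (1 - (t : ℂ) ^ r) ^ v)) :=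
    funext fun t => segDensity_eq hr u v s n t
  rw [this]
  exact (radial_integral hr u v hu hv n).1.const_mul _

lemma sum_zpow_omega {r : ℕ} (hr : 0 < r) (m : ℤ) :
    ∑ s : Fin r, omega r ^ ((s : ℕ) * m) = if (r : ℤ) ∣ m then (r : ℂ) else 0 := by
  have hprim := omega_isPrimitiveRoot hr
  have e : ∀ s : Fin r, omega r ^ ((s : ℕ) * m) = (omega r ^ m) ^ (s : ℕ) := fun s => by
    rw [mul_comm, zpow_mul, zpow_natCast]
  simp_rw [e]
  rw [Fin.sum_univ_eq_sum_range (fun s => (omega r ^ m) ^ s) r]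
  split_ifs with h
  · rw [(hprim.zpow_eq_one_iff_dvd m).2 h]; simp
  · have h1 : omega r ^ m ≠ 1 := fun h' => h ((hprim.zpow_eq_one_iff_dvd m).1 h')
    rw [geom_sum_eq h1, ← zpow_natCast, ← zpow_mul, mul_comm m, zpow_mul, zpow_natCast,
      hprim.pow_eq_one]
    simp

/-- The moments are Beta integrals on a residue class, and vanish off it. -/
lemma moment_eq {r : ℕ} (hr : 0 < r) (a : ℕ) (u v : ℂ)
    (hu : -1 / (r : ℝ) < u.re) (hv : -1 < v.re) (n : ℕ) :
    moment r a u v n = if n + 1 ≡ a [MOD r] then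
      1 / (2 * (Real.pi : ℂ)) * (Complex.Gamma (((n : ℂ) + 1) / r + u) * Complex.Gamma (v + 1) /
        Complex.Gamma (((n : ℂ) + 1) / r + u + (v + 1))) else 0 := by
  have hrp : (0 : ℝ) < r := by exact_mod_cast hr
  have hr0 : (r : ℂ) ≠ 0 := by exact_mod_cast hr.ne'
  have hre : 0 < (((n : ℂ) + 1) / r + u).re := by
    have : (((n : ℂ) + 1) / r + u).re = ((n : ℝ) + 1) / r + u.re := by
      rw [Complex.add_re, Complex.div_natCast_re]; simp
    rw [this]
    have : (1 : ℝ) / r ≤ ((n : ℝ) + 1) / r := by gcongr; simp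
    rw [neg_div] at hu
    linarith
  have hve : 0 < (v + 1).re := by simp; linarith
  have hG : Complex.Gamma (((n : ℂ) + 1) / r + u + (v + 1)) ≠ 0 := by
    apply Complex.Gamma_ne_zero_of_re_pos
    rw [Complex.add_re]; positivity
  have hB := Complex.Gamma_mul_Gamma_eq_betaIntegral hre hve
  rw [hB, mul_div_cancel_left₀ _ hG]
  have h1 : moment r a u v n = (∑ s : Fin r, omega r ^ ((s : ℕ) * ((n : ℤ) + 1 - a))) *
      (1 / (2 * (Real.pi : ℂ)) * ((1 / (r : ℂ)) *
        Complex.betaIntegral (((n : ℂ) + 1) / r + u) (v + 1))) := by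
    rw [moment, Finset.sum_mul]
    refine Finset.sum_congr rfl fun s _ => ?_
    simp_rw [segDensity_eq hr]
    rw [integral_const_mul, (radial_integral hr u v hu hv n).2]
    have hw : omega r ≠ 0 := (omega_isPrimitiveRoot hr).ne_zero hr.ne'
    have : omega r ^ ((s : ℕ) * ((n : ℤ) + 1 - a)) =
        (omega r ^ ((s : ℕ) * a))⁻¹ * omega r ^ ((s : ℕ) * (n + 1)) := by
      rw [← zpow_natCast, ← zpow_natCast, ← zpow_neg, ← zpow_add₀ hw]
      congr 1; push_cast; ring
    rw [this]; ring
  rw [h1, sum_zpow_omega hr]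
  have hiff : (r : ℤ) ∣ ((n : ℤ) + 1 - a) ↔ n + 1 ≡ a [MOD r] := by
    rw [Nat.ModEq.comm, Nat.modEq_iff_dvd]; push_cast; rfl
  simp only [hiff]
  split_ifs
  · field_simp
  · simp

open Equiv in
lemma sum_sign_mul_sign_prod {N : ℕ} (M : Matrix (Fin N) (Fin N) ℂ) :
    ∑ σ : Perm (Fin N), ∑ τ : Perm (Fin N),
      ((σ.sign : ℤ) : ℂ) * ((τ.sign : ℤ) : ℂ) * ∏ i, M (σ i) (τ i) =
      (N.factorial : ℂ) * M.det := by
  rw [Finset.sum_comm]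
  have : ∀ τ : Perm (Fin N), ∑ σ : Perm (Fin N),
      ((σ.sign : ℤ) : ℂ) * ((τ.sign : ℤ) : ℂ) * ∏ i, M (σ i) (τ i) = M.det := by
    intro τ
    rw [Matrix.det_apply', ← Equiv.sum_comp (Equiv.mulRight τ)]
    refine Finset.sum_congr rfl fun ρ _ => ?_
    rw [← Equiv.prod_comp τ (fun i => M (ρ i) i)]
    simp only [Equiv.coe_mulRight, Perm.sign_mul, Perm.coe_mul, Function.comp_apply]
    congr 1
    have h : ((τ.sign : ℤ) : ℂ) * ((τ.sign : ℤ) : ℂ) = 1 := by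
      rw [← Int.cast_mul, ← Units.val_mul, Int.units_mul_self]; simp
    push_cast
    rw [mul_assoc, h, mul_one]
  rw [Finset.sum_congr rfl fun τ _ => this τ]
  simp [Fintype.card_perm]

lemma det_pow_eq_sum {N : ℕ} (l : Fin N → ℕ) (x : Fin N → ℂ) :
    Matrix.det (Matrix.of fun i j : Fin N => x i ^ l j) =
      ∑ σ : Equiv.Perm (Fin N), ((σ.sign : ℤ) : ℂ) * ∏ i, x i ^ l (σ i) := by
  rw [← Matrix.det_transpose, Matrix.det_apply']
  rfl

lemma density_segPoint {r N : ℕ} (u v : ℂ) {O : (Fin N → ℂ) → ℂ} {l k : Fin N → ℕ}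
    (hO : ∀ x : Fin N → ℂ,
      O x * (∏ i : Fin N, ∏ k ∈ Finset.univ.filter (fun k => i < k), (x i - x k) ^ 2) =
        Matrix.det (Matrix.of fun i j : Fin N => x i ^ l j) *
          Matrix.det (Matrix.of fun i j : Fin N => x i ^ k j))
    (j : Fin N → Fin r) (t : Fin N → ℝ) :
    density r N u v O (segPoint r N j t) * ∏ i : Fin N, omega r ^ (j i : ℕ) =
      ∑ σ : Equiv.Perm (Fin N), ∑ τ : Equiv.Perm (Fin N),
        ((σ.sign : ℤ) : ℂ) * ((τ.sign : ℤ) : ℂ) *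
          ∏ i, segDensity r u v (j i) (l (σ i) + k (τ i)) (t i) := by
  set x := segPoint r N j t with hx
  have h : density r N u v O x * ∏ i : Fin N, omega r ^ (j i : ℕ) =
      (Matrix.det (Matrix.of fun i j : Fin N => x i ^ l j) *
          Matrix.det (Matrix.of fun i j : Fin N => x i ^ k j)) *
        ∏ i : Fin N, (1 / (2 * (Real.pi : ℂ)) * ((x i ^ r) ^ u * (1 - x i ^ r) ^ v) *
          omega r ^ (j i : ℕ)) := by
    rw [← hO, density]
    simp only [Finset.prod_mul_distrib]
    ring
  rw [h, det_pow_eq_sum, det_pow_eq_sum, Finset.sum_mul_sum, Finset.sum_mul]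
  refine Finset.sum_congr rfl fun σ _ => ?_
  rw [Finset.sum_mul]
  refine Finset.sum_congr rfl fun τ _ => ?_
  have : ∀ i, segDensity r u v (j i) (l (σ i) + k (τ i)) (t i) =
      x i ^ l (σ i) * x i ^ k (τ i) * (1 / (2 * (Real.pi : ℂ)) *
        ((x i ^ r) ^ u * (1 - x i ^ r) ^ v) * omega r ^ (j i : ℕ)) := by
    intro i
    rw [segDensity, pow_add]
    simp only [hx, segPoint]
    ring
  simp_rw [this]
  simp only [Finset.prod_mul_distrib]
  ring

lemma volume_restrict_cube (N : ℕ) :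
    (volume : Measure (Fin N → ℝ)).restrict (cube N) =
      Measure.pi fun _ => volume.restrict (Set.Icc (0 : ℝ) 1) := by
  rw [cube, volume_pi, Measure.restrict_pi_pi]

lemma integrableOn_cube_prod {r N : ℕ} (hr : 0 < r) (u v : ℂ)
    (hu : -1 / (r : ℝ) < u.re) (hv : -1 < v.re) (j : Fin N → Fin r) (n : Fin N → ℕ) :
    IntegrableOn (fun t => ∏ i, segDensity r u v (j i) (n i) (t i)) (cube N) := by
  rw [IntegrableOn, volume_restrict_cube]
  exact Integrable.fintype_prod (f := fun i => segDensity r u v (j i) (n i))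
    fun i => segDensity_integrableOn hr u v hu hv (j i) (n i)

lemma integral_cube_prod {r N : ℕ} (u v : ℂ) (j : Fin N → Fin r) (n : Fin N → ℕ) :
    ∫ t in cube N, ∏ i, segDensity r u v (j i) (n i) (t i) =
      ∏ i, ∫ t in Set.Icc (0 : ℝ) 1, segDensity r u v (j i) (n i) t := by
  rw [volume_restrict_cube]
  exact integral_fintype_prod_eq_prod (fun i => segDensity r u v (j i) (n i))

/-- **Andréief's identity** for the model. -/
theorem converges_and_Z_eq_det {r a N : ℕ} (hr : 0 < r) (u v : ℂ)
    (hu : -1 / (r : ℝ) < u.re) (hv : -1 < v.re) {O : (Fin N → ℂ) → ℂ} {l k : Fin N → ℕ}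
    (hO : ∀ x : Fin N → ℂ,
      O x * (∏ i : Fin N, ∏ k ∈ Finset.univ.filter (fun k => i < k), (x i - x k) ^ 2) =
        Matrix.det (Matrix.of fun i j : Fin N => x i ^ l j) *
          Matrix.det (Matrix.of fun i j : Fin N => x i ^ k j)) :
    Converges r N u v O ∧
      Z r a N u v O = Matrix.det (Matrix.of fun i j : Fin N => moment r a u v (l i + k j)) := by
  have hw : omega r ≠ 0 := (omega_isPrimitiveRoot hr).ne_zero hr.ne'
  constructor
  · intro j
    have hc : (∏ i : Fin N, omega r ^ (j i : ℕ)) ≠ 0 :=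
      Finset.prod_ne_zero_iff.2 fun i _ => pow_ne_zero _ hw
    have : (fun t => density r N u v O (segPoint r N j t)) = fun t =>
        (∑ σ : Equiv.Perm (Fin N), ∑ τ : Equiv.Perm (Fin N),
        ((σ.sign : ℤ) : ℂ) * ((τ.sign : ℤ) : ℂ) *
          ∏ i, segDensity r u v (j i) (l (σ i) + k (τ i)) (t i)) *
          (∏ i : Fin N, omega r ^ (j i : ℕ))⁻¹ := by
      funext t
      rw [← density_segPoint u v hO, mul_inv_cancel_right₀ hc]
    rw [this]
    refine Integrable.mul_const (integrable_finsetSum _ fun σ _ => integrable_finsetSum _ fun τ _ =>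
      Integrable.const_mul ?_ _) _
    exact integrableOn_cube_prod hr u v hu hv j _
  · have hseg : ∀ j, segIntegral r N j (density r N u v O) =
        ∑ σ : Equiv.Perm (Fin N), ∑ τ : Equiv.Perm (Fin N),
        ((σ.sign : ℤ) : ℂ) * ((τ.sign : ℤ) : ℂ) *
          ∏ i, ∫ t in Set.Icc (0 : ℝ) 1, segDensity r u v (j i) (l (σ i) + k (τ i)) t := by
      intro j
      rw [segIntegral]
      simp_rw [density_segPoint u v hO]
      have hi : ∀ σ τ : Equiv.Perm (Fin N), IntegrableOn (fun t : Fin N → ℝ =>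
          ((σ.sign : ℤ) : ℂ) * ((τ.sign : ℤ) : ℂ) *
          ∏ i, segDensity r u v (j i) (l (σ i) + k (τ i)) (t i)) (cube N) := fun σ τ =>
        Integrable.const_mul (integrableOn_cube_prod hr u v hu hv j _) _
      rw [integral_finsetSum _ fun σ _ => integrable_finsetSum _ fun τ _ => hi σ τ]
      refine Finset.sum_congr rfl fun σ _ => ?_
      rw [integral_finsetSum _ fun τ _ => hi σ τ]
      refine Finset.sum_congr rfl fun τ _ => ?_
      rw [integral_const_mul, integral_cube_prod]
    have hcont : contourIntegral r a N (density r N u v O) =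
        ∑ σ : Equiv.Perm (Fin N), ∑ τ : Equiv.Perm (Fin N),
        ((σ.sign : ℤ) : ℂ) * ((τ.sign : ℤ) : ℂ) *
          ∏ i, moment r a u v (l (σ i) + k (τ i)) := by
      rw [contourIntegral]
      simp_rw [hseg, Finset.mul_sum]
      rw [Finset.sum_comm]
      refine Finset.sum_congr rfl fun σ _ => ?_
      rw [Finset.sum_comm]
      refine Finset.sum_congr rfl fun τ _ => ?_
      simp only [moment]
      rw [Finset.prod_univ_sum, Fintype.piFinset_univ, Finset.mul_sum]
      refine Finset.sum_congr rfl fun j _ => ?_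
      rw [Finset.prod_mul_distrib]
      ring
    rw [Z, hcont]
    have := sum_sign_mul_sign_prod (Matrix.of fun i j : Fin N => moment r a u v (l i + k j))
    simp only [Matrix.of_apply] at this
    rw [this]
    have : (N.factorial : ℂ) ≠ 0 := by exact_mod_cast N.factorial_ne_zero
    field_simp

lemma det_alternant_sq {N : ℕ} (x : Fin N → ℂ) :
    (∏ i : Fin N, ∏ k ∈ Finset.univ.filter (fun k => i < k), (x i - x k) ^ 2) =
      Matrix.det (Matrix.of fun i j : Fin N => x i ^ (N - 1 - (j : ℕ))) ^ 2 := by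
  have h : (Matrix.of fun i j : Fin N => x i ^ (N - 1 - (j : ℕ))) =
      (Matrix.vandermonde x).submatrix id Fin.revPerm := by
    ext i j
    simp only [Matrix.of_apply, Matrix.submatrix_apply, Matrix.vandermonde_apply, id,
      Fin.revPerm_apply, Fin.val_rev]
    congr 1; omega
  have hs : (((Fin.revPerm (n := N)).sign : ℤ) : ℂ) ^ 2 = 1 := by
    rw [sq, ← Int.cast_mul, ← Units.val_mul, Int.units_mul_self]; simp
  rw [h, Matrix.det_permute', mul_pow, hs, one_mul, Matrix.det_vandermonde,
    ← Finset.prod_pow]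
  refine Finset.prod_congr rfl fun i _ => ?_
  rw [← Finset.prod_pow]
  refine Finset.prod_congr (by ext; simp) fun k _ => by ring

theorem one_converges_and_Z_eq {r a N : ℕ} (hr : 0 < r) (u v : ℂ)
    (hu : -1 / (r : ℝ) < u.re) (hv : -1 < v.re) :
    Converges r N u v (fun _ => 1) ∧ partitionFunction r a N u v =
      Matrix.det (Matrix.of fun i j : Fin N =>
        moment r a u v ((N - 1 - (i : ℕ)) + (N - 1 - (j : ℕ)))) :=
  converges_and_Z_eq_det (a := a) hr u v hu hv (l := fun i => N - 1 - (i : ℕ))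
    (k := fun i => N - 1 - (i : ℕ)) fun x => by rw [one_mul, det_alternant_sq, sq]

theorem schur_converges_and_Z_eq {r a N : ℕ} (hr : 0 < r) (u v : ℂ)
    (hu : -1 / (r : ℝ) < u.re) (hv : -1 < v.re) (lam : YoungDiagram) :
    Converges r N u v (schur N lam) ∧ Z r a N u v (schur N lam) =
      Matrix.det (Matrix.of fun i j : Fin N =>
        moment r a u v ((N - 1 - (i : ℕ) + lam.rowLen i) + (N - 1 - (j : ℕ)))) :=
  converges_and_Z_eq_det (a := a) hr u v hu hv (l := fun i => N - 1 - (i : ℕ) + lam.rowLen i)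
    (k := fun i => N - 1 - (i : ℕ)) fun x => by
      rw [det_alternant_sq, schur]
      by_cases h : Matrix.det (Matrix.of fun i j : Fin N => x i ^ (N - 1 - (j : ℕ))) = 0
      · simp [h]
      · rw [sq, ← mul_assoc, div_mul_cancel₀ _ h]

end Andreief

section Diagrams

open Finset

/-- The beta numbers of `lam` with respect to `N` rows. -/
def beta (N : ℕ) (lam : YoungDiagram) (i : ℕ) : ℕ := N - 1 - i + lam.rowLen i

lemma lt_colLen_iff {lam : YoungDiagram} {i j : ℕ} : i < lam.colLen j ↔ j < lam.rowLen i := by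
  rw [← YoungDiagram.mem_iff_lt_colLen, YoungDiagram.mem_iff_lt_rowLen]

lemma rowLen_bot (i : ℕ) : (⊥ : YoungDiagram).rowLen i = 0 := by
  by_contra h
  exact YoungDiagram.notMem_bot (i, 0) (YoungDiagram.mem_iff_lt_rowLen.2 (Nat.pos_of_ne_zero h))

lemma colLen_bot (j : ℕ) : (⊥ : YoungDiagram).colLen j = 0 := by
  by_contra h
  exact YoungDiagram.notMem_bot (0, j) (YoungDiagram.mem_iff_lt_colLen.2 (Nat.pos_of_ne_zero h))

lemma beta_bot (N i : ℕ) : beta N ⊥ i = N - 1 - i := by rw [beta, rowLen_bot, add_zero]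

lemma beta_lt_beta {N : ℕ} (lam : YoungDiagram) {i k : ℕ} (hik : i < k) (hk : k < N) :
    beta N lam k < beta N lam i := by
  have := lam.rowLen_anti i k hik.le
  unfold beta; omega

@[to_additive]
lemma prod_cells {M : Type*} [CommMonoid M] {N : ℕ} {lam : YoungDiagram}
    (hN : lam.colLen 0 ≤ N) (f : ℕ × ℕ → M) :
    ∏ x ∈ lam.cells, f x = ∏ i ∈ range N, ∏ j ∈ range (lam.rowLen i), f (i, j) := by
  refine Finset.prod_finset_product _ _ _ fun p => ?_
  rw [YoungDiagram.mem_cells, mem_range, mem_range, ← YoungDiagram.mem_iff_lt_rowLen]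
  refine ⟨fun h => ⟨?_, h⟩, fun h => h.2⟩
  have h1 := YoungDiagram.mem_iff_lt_colLen.1 (show (p.1, p.2) ∈ lam from h)
  have h2 := lam.colLen_anti 0 p.2 (Nat.zero_le _)
  omega

/-- The hook lengths of the cells in row `i`, as natural numbers. -/
lemma hookLength_eq {lam : YoungDiagram} {i j : ℕ} (h : j < lam.rowLen i) :
    hookLength lam (i, j) = ((lam.rowLen i + lam.colLen j - i - j - 1 : ℕ) : ℤ) := by
  have := lt_colLen_iff.2 h
  simp only [hookLength]
  omega

/-- The hook lengths in row `i` and the differences of the `i`-th beta number with the smaller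
beta numbers together make up the interval from `1` to the `i`-th beta number. -/
lemma hooks_disjoint_union {N : ℕ} {lam : YoungDiagram} (hN : lam.colLen 0 ≤ N) {i : ℕ}
    (hi : i < N) :
    Set.InjOn (fun j => lam.rowLen i + lam.colLen j - i - j - 1) (range (lam.rowLen i)) ∧
    Set.InjOn (fun k => beta N lam i - beta N lam k) (Ioo i N) ∧
    Disjoint ((range (lam.rowLen i)).image fun j => lam.rowLen i + lam.colLen j - i - j - 1)
      ((Ioo i N).image fun k => beta N lam i - beta N lam k) ∧
    ((range (lam.rowLen i)).image fun j => lam.rowLen i + lam.colLen j - i - j - 1) ∪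
      ((Ioo i N).image fun k => beta N lam i - beta N lam k) = Icc 1 (beta N lam i) := by
  have hcol : ∀ j, lam.colLen j ≤ N := fun j => (lam.colLen_anti 0 j (Nat.zero_le _)).trans hN
  have inj1 : Set.InjOn (fun j => lam.rowLen i + lam.colLen j - i - j - 1)
      (range (lam.rowLen i)) := by
    intro j hj k hk h
    simp only [coe_range, Set.mem_Iio] at hj hk h
    have h1 := lt_colLen_iff.2 hj
    have h2 := lt_colLen_iff.2 hk
    rcases lt_trichotomy j k with hjk | hjk | hjk
    · have := lam.colLen_anti j k hjk.le
      omega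
    · exact hjk
    · have := lam.colLen_anti k j hjk.le
      omega
  have inj2 : Set.InjOn (fun k => beta N lam i - beta N lam k) (Ioo i N) := by
    intro j hj k hk h
    simp only [coe_Ioo, Set.mem_Ioo] at hj hk h
    have h1 := beta_lt_beta lam hj.1 hj.2
    have h2 := beta_lt_beta lam hk.1 hk.2
    rcases lt_trichotomy j k with hjk | hjk | hjk
    · have := beta_lt_beta lam hjk hk.2
      omega
    · exact hjk
    · have := beta_lt_beta lam hjk hj.2
      omega
  have disj : Disjoint
      ((range (lam.rowLen i)).image fun j => lam.rowLen i + lam.colLen j - i - j - 1)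
      ((Ioo i N).image fun k => beta N lam i - beta N lam k) := by
    rw [Finset.disjoint_left]
    intro n hn hn'
    simp only [mem_image, mem_range, mem_Ioo] at hn hn'
    obtain ⟨j, hj, rfl⟩ := hn
    obtain ⟨k, ⟨hik, hk⟩, h⟩ := hn'
    have h1 := lt_colLen_iff.2 hj
    have h2 := lam.rowLen_anti i k hik.le
    have h3 : k < lam.colLen j ↔ j < lam.rowLen k := lt_colLen_iff
    unfold beta at h
    by_cases hc : k < lam.colLen j
    · have := h3.1 hc
      omega
    · have : ¬ j < lam.rowLen k := fun h' => hc (h3.2 h')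
      omega
  refine ⟨inj1, inj2, disj, ?_⟩
  apply Finset.eq_of_subset_of_card_le
  · intro n hn
    simp only [mem_union, mem_image, mem_range, mem_Ioo, mem_Icc] at hn ⊢
    rcases hn with ⟨j, hj, rfl⟩ | ⟨k, ⟨hik, hk⟩, rfl⟩
    · have h1 := lt_colLen_iff.2 hj
      have := hcol j
      unfold beta
      omega
    · have := beta_lt_beta lam hik hk
      omega
  · rw [card_union_of_disjoint disj, card_image_of_injOn inj1, card_image_of_injOn inj2]
    simp only [Nat.card_Icc, card_range, Nat.card_Ioo]
    unfold beta
    omega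

lemma prod_hooks_row {M : Type*} [CommMonoid M] {N : ℕ} {lam : YoungDiagram}
    (hN : lam.colLen 0 ≤ N) {i : ℕ} (hi : i < N) (h : ℤ → M) :
    (∏ j ∈ range (lam.rowLen i), h (hookLength lam (i, j))) *
      ∏ k ∈ Ioo i N, h ((beta N lam i : ℤ) - (beta N lam k : ℤ)) =
      ∏ n ∈ Icc 1 (beta N lam i), h (n : ℤ) := by
  obtain ⟨inj1, inj2, disj, hun⟩ := hooks_disjoint_union hN hi
  rw [← hun, prod_union disj, prod_image inj1, prod_image inj2]
  congr 1
  · refine prod_congr rfl fun j hj => ?_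
    rw [hookLength_eq (mem_range.1 hj)]
  · refine prod_congr rfl fun k hk => ?_
    have hk := mem_Ioo.1 hk
    rw [Nat.cast_sub (beta_lt_beta lam hk.1 hk.2).le]

lemma prod_contents_row {M : Type*} [CommMonoid M] {N : ℕ} {lam : YoungDiagram} {i : ℕ}
    (hi : i < N) (g : ℤ → M) :
    (∏ j ∈ range (lam.rowLen i), g ((N : ℤ) + content (i, j))) *
      ∏ n ∈ Icc 1 (N - 1 - i), g (n : ℤ) = ∏ n ∈ Icc 1 (beta N lam i), g (n : ℤ) := by
  have e : ∀ m : ℕ, ∏ n ∈ Icc 1 m, g (n : ℤ) = ∏ n ∈ range m, g ((n : ℤ) + 1) := by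
    intro m
    rw [← Ico_succ_right_eq_Icc, Finset.prod_Ico_eq_prod_range]
    refine prod_congr (by simp) fun n _ => ?_
    congr 1; push_cast; ring
  rw [e, e, beta, prod_range_add, mul_comm]
  congr 1
  refine prod_congr rfl fun j _ => ?_
  congr 1
  simp only [content]
  omega

/-! ### Stripping rim hooks -/

lemma mem_sdiff_rimHook {lam : YoungDiagram} {i j i' j' : ℕ} :
    (i', j') ∈ lam.cells \ rimHook lam (i, j) ↔
      j' < lam.rowLen i' ∧ ¬ (i ≤ i' ∧ j ≤ j' ∧ ¬ (j' + 1 < lam.rowLen (i' + 1))) := by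
  simp only [rimHook, mem_sdiff, mem_filter, YoungDiagram.mem_cells,
    YoungDiagram.mem_iff_lt_rowLen]
  tauto

/-- Removing the rim hook of a cell leaves a Young diagram. -/
def stripRimHook (lam : YoungDiagram) (x : ℕ × ℕ) : YoungDiagram where
  cells := lam.cells \ rimHook lam x
  isLowerSet := by
    rintro ⟨y1, y2⟩ ⟨z1, z2⟩ ⟨h1, h2⟩ hy
    obtain ⟨i, j⟩ := x
    simp only [mem_coe, mem_sdiff_rimHook] at h1 h2 hy ⊢
    have a1 := lam.rowLen_anti z1 y1 h1
    have a2 := lam.rowLen_anti (z1 + 1) (y1 + 1) (by omega)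
    omega

lemma rowLen_strip {lam mu : YoungDiagram} {i j : ℕ}
    (hmu : mu.cells = lam.cells \ rimHook lam (i, j)) (k : ℕ) :
    mu.rowLen k = if k < i ∨ lam.colLen j ≤ k then lam.rowLen k
      else if k + 1 < lam.colLen j then lam.rowLen (k + 1) - 1 else j := by
  have key : ∀ m, m < mu.rowLen k ↔
      m < lam.rowLen k ∧ ¬ (i ≤ k ∧ j ≤ m ∧ ¬ (m + 1 < lam.rowLen (k + 1))) := by
    intro m
    rw [← YoungDiagram.mem_iff_lt_rowLen, ← YoungDiagram.mem_cells, hmu, mem_sdiff_rimHook]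
  refine eq_of_forall_lt_iff fun m => ?_
  rw [key]
  have c0 : k < lam.colLen j ↔ j < lam.rowLen k := lt_colLen_iff
  have c1 : k + 1 < lam.colLen j ↔ j < lam.rowLen (k + 1) := lt_colLen_iff
  have a1 := lam.rowLen_anti k (k + 1) (by omega)
  split_ifs with h1 h2
  · omega
  · have := c1.1 h2
    omega
  · have h3 : ¬ j < lam.rowLen (k + 1) := fun h => h2 (c1.2 h)
    have h4 : j < lam.rowLen k := c0.1 (by omega)
    omega

lemma sum_cyclic_shift {M : Type*} [AddCommMonoid M] {b b' : ℕ → ℕ} {i T N : ℕ} (hiT : i ≤ T)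
    (hT : T < N) (h1 : ∀ k, k < i → b' k = b k) (h2 : ∀ k, T < k → b' k = b k)
    (h3 : ∀ k, i ≤ k → k < T → b' k = b (k + 1)) (f : ℕ → M) :
    ∑ k ∈ range N, f (b' k) + f (b i) = ∑ k ∈ range N, f (b k) + f (b' T) := by
  have split : ∀ g : ℕ → M, ∑ k ∈ range N, g k =
      ∑ k ∈ Ico 0 i, g k + ∑ k ∈ Ico i (T + 1), g k + ∑ k ∈ Ico (T + 1) N, g k := by
    intro g
    rw [range_eq_Ico, sum_Ico_consecutive g (Nat.zero_le i) (by omega),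
      sum_Ico_consecutive g (Nat.zero_le _) (by omega)]
  have e1 : ∑ k ∈ Ico 0 i, f (b' k) = ∑ k ∈ Ico 0 i, f (b k) :=
    sum_congr rfl fun k hk => by rw [h1 k (mem_Ico.1 hk).2]
  have e2 : ∑ k ∈ Ico (T + 1) N, f (b' k) = ∑ k ∈ Ico (T + 1) N, f (b k) :=
    sum_congr rfl fun k hk => by rw [h2 k (mem_Ico.1 hk).1]
  have e3 : ∑ k ∈ Ico i T, f (b' k) = ∑ k ∈ Ico (i + 1) (T + 1), f (b k) := by
    rw [← sum_Ico_add']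
    exact sum_congr rfl fun k hk => by rw [h3 k (mem_Ico.1 hk).1 (mem_Ico.1 hk).2]
  rw [split, split (fun k => f (b k)), e1, e2, sum_Ico_succ_top hiT, e3,
    sum_eq_sum_Ico_succ_bot (by omega : i < T + 1) (fun k => f (b k))]
  abel

/-- Stripping a rim hook lowers one beta number by the length of the hook. -/
lemma sum_beta_strip {M : Type*} [AddCommMonoid M] {N r : ℕ} {lam mu : YoungDiagram}
    (hN : lam.colLen 0 ≤ N) (h : StripsRimHook r lam mu) :
    ∃ l, r ≤ l ∧ ∀ f : ℕ → M,
      ∑ k ∈ range N, f (beta N mu k) + f l = ∑ k ∈ range N, f (beta N lam k) + f (l - r) := by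
  obtain ⟨⟨i, j⟩, hx, hr, hmu⟩ := h
  have hj := YoungDiagram.mem_iff_lt_rowLen.1 hx
  have hi := lt_colLen_iff.2 hj
  have hcol : lam.colLen j ≤ N := (lam.colLen_anti 0 j (Nat.zero_le _)).trans hN
  rw [hookLength_eq hj] at hr
  have hrow := rowLen_strip hmu
  have hbT : beta N mu (lam.colLen j - 1) = beta N lam i - r := by
    rw [beta, hrow, if_neg (by omega), if_neg (by omega), beta]
    omega
  refine ⟨beta N lam i, ?_, fun f => ?_⟩
  · unfold beta; omega
  · rw [← hbT]
    refine sum_cyclic_shift (by omega) (by omega) (fun k hk => ?_) (fun k hk => ?_)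
      (fun k hk hk' => ?_) f
    · rw [beta, hrow, if_pos (Or.inl hk), beta]
    · rw [beta, hrow, if_pos (by omega), beta]
    · have : k + 1 < lam.colLen j := by omega
      have h3 := lt_colLen_iff.1 this
      rw [beta, hrow, if_neg (by omega), if_pos this, beta]
      omega

lemma strip_le {r : ℕ} {lam mu : YoungDiagram} (h : StripsRimHook r lam mu) : mu < lam := by
  obtain ⟨⟨i, j⟩, hx, -, hmu⟩ := h
  rw [← YoungDiagram.cells_ssubset_iff, hmu]
  have hj := YoungDiagram.mem_iff_lt_rowLen.1 hx
  refine Finset.sdiff_ssubset (filter_subset _ _) ⟨(i, lam.rowLen i - 1), ?_⟩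
  have a1 := lam.rowLen_anti i (i + 1) (by omega)
  simp only [rimHook, mem_filter, YoungDiagram.mem_cells, YoungDiagram.mem_iff_lt_rowLen]
  omega

lemma colLen_mono {lam mu : YoungDiagram} (h : mu ≤ lam) (j : ℕ) : mu.colLen j ≤ lam.colLen j := by
  refine le_of_forall_lt fun k hk => ?_
  rw [← YoungDiagram.mem_iff_lt_colLen] at hk ⊢
  exact h hk

lemma exists_isRCore (r : ℕ) (lam : YoungDiagram) : ∃ kappa, IsRCore r lam kappa := by
  induction hn : lam.card using Nat.strong_induction_on generalizing lam with
  | _ n ih =>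
    by_cases h : ∃ mu, StripsRimHook r lam mu
    · obtain ⟨mu, hmu⟩ := h
      have hlt : mu.card < lam.card :=
        Finset.card_lt_card (YoungDiagram.cells_ssubset_iff.2 (strip_le hmu))
      obtain ⟨kappa, hk⟩ := ih _ (hn ▸ hlt) mu rfl
      exact ⟨kappa, Relation.ReflTransGen.head hmu hk.1, hk.2⟩
    · exact ⟨lam, Relation.ReflTransGen.refl, fun mu hmu => h ⟨mu, hmu⟩⟩

/-- The number of beta numbers in a residue class. -/
def residueCount (r N : ℕ) (lam : YoungDiagram) (c : ℕ) : ℕ :=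
  ∑ k ∈ range N, if beta N lam k % r = c then 1 else 0

lemma residueCount_strip {r N : ℕ} {lam mu : YoungDiagram} (hN : lam.colLen 0 ≤ N)
    (h : StripsRimHook r lam mu) (c : ℕ) : residueCount r N mu c = residueCount r N lam c := by
  obtain ⟨l, hl, hf⟩ := sum_beta_strip (M := ℕ) hN h
  have := hf fun m => if m % r = c then 1 else 0
  have e : (l - r) % r = l % r := (Nat.mod_eq_sub_mod hl).symm
  rw [e] at this
  exact Nat.add_right_cancel this

lemma residueCount_reflTransGen {r N : ℕ} {lam kappa : YoungDiagram} (hN : lam.colLen 0 ≤ N)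
    (h : Relation.ReflTransGen (StripsRimHook r) lam kappa) :
    kappa.colLen 0 ≤ N ∧ ∀ c, residueCount r N kappa c = residueCount r N lam c := by
  induction h with
  | refl => exact ⟨hN, fun _ => rfl⟩
  | tail _ hs ih =>
    exact ⟨(colLen_mono (strip_le hs).le 0).trans ih.1,
      fun c => (residueCount_strip ih.1 hs c).trans (ih.2 c)⟩

lemma exists_strip {r N : ℕ} (hr : 0 < r) {lam : YoungDiagram} (hN : lam.colLen 0 ≤ N) {i : ℕ}
    (hi : i < N) (hl : r ≤ beta N lam i) (hk : ∀ k < N, beta N lam k ≠ beta N lam i - r) :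
    ∃ mu, StripsRimHook r lam mu := by
  have hmem : r ∈ Icc 1 (beta N lam i) := mem_Icc.2 ⟨hr, hl⟩
  rw [← (hooks_disjoint_union hN hi).2.2.2] at hmem
  simp only [mem_union, mem_image, mem_range, mem_Ioo] at hmem
  rcases hmem with ⟨j, hj, h⟩ | ⟨k, ⟨hik, hkN⟩, h⟩
  · exact ⟨stripRimHook lam (i, j), (i, j), YoungDiagram.mem_iff_lt_rowLen.2 hj,
      by rw [hookLength_eq hj, h], rfl⟩
  · have := beta_lt_beta lam hik hkN
    exact absurd (by omega) (hk k hkN)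

lemma eq_bot_of_no_strip {r N : ℕ} (hr : 0 < r) {lam : YoungDiagram} (hN : lam.colLen 0 ≤ N)
    (hs : ∀ mu, ¬ StripsRimHook r lam mu)
    (hc : ∀ c, residueCount r N lam c = residueCount r N ⊥ c) : lam = ⊥ := by
  have hclosed : ∀ i < N, r ≤ beta N lam i → ∃ k < N, beta N lam k = beta N lam i - r := by
    intro i hi hl
    by_contra! h
    obtain ⟨mu, hmu⟩ := exists_strip hr hN hi hl h
    exact hs mu hmu
  have hdown : ∀ q m, (∃ k < N, beta N lam k = m + r * q) → ∃ k < N, beta N lam k = m := by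
    intro q
    induction q with
    | zero => intro m h; simpa using h
    | succ q ih =>
      rintro m ⟨k, hk, h⟩
      refine ih m ?_
      have h' : beta N lam k = m + r * q + r := by rw [h]; ring
      obtain ⟨k', hk', e⟩ := hclosed k hk (by omega)
      exact ⟨k', hk', by omega⟩
  have hinj : Set.InjOn (beta N lam) (range N) := by
    intro i hi k hk h
    simp only [coe_range, Set.mem_Iio] at hi hk
    rcases lt_trichotomy i k with h' | h' | h'
    · have := beta_lt_beta lam h' hk; omega
    · exact h'
    · have := beta_lt_beta lam h' hi; omega
  have hcount : ∀ c, residueCount r N lam c = #{m ∈ (range N).image (beta N lam) | m % r = c} := by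
    intro c
    rw [residueCount, card_filter, sum_image hinj]
  have hcount' : ∀ c, residueCount r N ⊥ c = #{m ∈ range N | m % r = c} := by
    intro c
    rw [residueCount, card_filter, ← sum_range_reflect]
    refine sum_congr rfl fun k hk => ?_
    have := mem_range.1 hk
    rw [beta_bot, show N - 1 - (N - 1 - k) = k by omega]
  have hlt : ∀ i < N, beta N lam i < N := by
    intro i hi
    by_contra! h
    set l := beta N lam i with hl
    have hcc := hc (l % r)
    rw [hcount, hcount'] at hcc
    have hsub : insert l {m ∈ range N | m % r = l % r} ⊆
        {m ∈ (range N).image (beta N lam) | m % r = l % r} := by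
      intro m hm
      rw [mem_insert, mem_filter, mem_range] at hm
      rw [mem_filter, mem_image]
      rcases hm with rfl | ⟨hmN, hm⟩
      · exact ⟨⟨i, mem_range.2 hi, rfl⟩, rfl⟩
      · refine ⟨?_, hm⟩
        have hq : l = m + r * (l / r - m / r) := by
          have h1 := Nat.div_add_mod l r
          have h2 := Nat.div_add_mod m r
          have h3 : m / r ≤ l / r := Nat.div_le_div_right (by omega)
          rw [Nat.mul_sub]
          have := Nat.mul_le_mul_left r h3
          omega
        obtain ⟨k, hk, e⟩ := hdown _ m ⟨i, hi, hq⟩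
        exact ⟨k, mem_range.2 hk, e⟩
    have := card_le_card hsub
    rw [card_insert_of_notMem (by simp; omega)] at this
    omega
  have h0 : lam.rowLen 0 = 0 := by
    rcases Nat.eq_zero_or_pos N with h | h
    · have : ¬ 0 < lam.colLen 0 := by omega
      rw [lt_colLen_iff] at this
      omega
    · have := hlt 0 h
      unfold beta at this
      omega
  rw [eq_bot_iff]
  rintro ⟨x, y⟩ hx
  have h1 := YoungDiagram.mem_iff_lt_rowLen.1 hx
  have h2 := lam.rowLen_anti 0 x (Nat.zero_le _)
  omega

lemma exists_perm_iff_sum_eq {N : ℕ} (f g : Fin N → ℕ) :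
    (∃ σ : Equiv.Perm (Fin N), ∀ i, f (σ i) = g i) ↔
      ∀ c, ∑ i, (if f i = c then 1 else 0 : ℕ) = ∑ i, (if g i = c then 1 else 0 : ℕ) := by
  constructor
  · rintro ⟨σ, h⟩ c
    rw [← Equiv.sum_comp σ]
    simp_rw [h]
  · intro h
    have hcard : ∀ c, Fintype.card {i // g i = c} = Fintype.card {i // f i = c} := by
      intro c
      rw [Fintype.card_subtype, Fintype.card_subtype, card_filter, card_filter, h c]
    refine ⟨Equiv.ofFiberEquiv (f := g) (g := f) fun c => Fintype.equivOfCardEq (hcard c),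
      fun i => Equiv.ofFiberEquiv_map _ i⟩

/-- A partition has empty `r`-core if and only if its beta numbers can be matched with
`0, …, N - 1` within the residue classes modulo `r`. -/
theorem isRCore_bot_iff {r N : ℕ} (hr : 0 < r) {lam : YoungDiagram} (hN : lam.colLen 0 ≤ N) :
    IsRCore r lam ⊥ ↔
      ∃ σ : Equiv.Perm (Fin N), ∀ i, beta N lam (σ i) % r = (i : ℕ) % r := by
  have h1 : IsRCore r lam ⊥ ↔ ∀ c, residueCount r N lam c = residueCount r N ⊥ c := by
    constructor
    · intro h c
      exact ((residueCount_reflTransGen hN h.1).2 c).symm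
    · intro h
      obtain ⟨kappa, hk⟩ := exists_isRCore r lam
      have h2 := residueCount_reflTransGen hN hk.1
      have := eq_bot_of_no_strip hr h2.1 hk.2 fun c => (h2.2 c).trans (h c)
      rwa [this] at hk
  have h2 := exists_perm_iff_sum_eq (fun i : Fin N => beta N lam i % r)
    (fun i : Fin N => (i : ℕ) % r)
  rw [h1, h2]
  refine forall_congr' fun c => ?_
  rw [residueCount, residueCount, Fin.sum_univ_eq_sum_range (fun k => if beta N lam k % r = c
    then 1 else 0), Fin.sum_univ_eq_sum_range (fun k => if k % r = c then 1 else 0),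
    ← sum_range_reflect (fun k => if k % r = c then 1 else 0)]
  simp_rw [beta_bot]

end Diagrams

section Residues

open Finset

/-! ### Residue classes -/

/-- The residue `c'` with `c + c' + 1 ≡ a` modulo `r`. -/
def partner (r a c : ℕ) : ℕ := if c < a then a - 1 - c else a + r - 1 - c

/-- The number of `k < N` that are congruent to `c < r` modulo `r`. -/
def classSize (r N c : ℕ) : ℕ := N / r + if c < N % r then 1 else 0

lemma partner_lt {r a c : ℕ} (ha : a < r) (hc : c < r) : partner r a c < r := by
  unfold partner; split_ifs <;> omega

lemma partner_partner {r a c : ℕ} (ha : a < r) (hc : c < r) :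
    partner r a (partner r a c) = c := by
  unfold partner; split_ifs <;> omega

lemma add_partner_modEq {r a c : ℕ} (hc : c < r) : c + partner r a c + 1 ≡ a [MOD r] := by
  unfold partner
  split_ifs with h
  · rw [show c + (a - 1 - c) + 1 = a by omega]
  · rw [show c + (a + r - 1 - c) + 1 = a + r by omega]
    exact Nat.add_modEq_right

lemma add_modEq_iff_partner {r a l k : ℕ} (hr : 0 < r) (ha : a < r) :
    l + k + 1 ≡ a [MOD r] ↔ k % r = partner r a (l % r) := by
  have hl := Nat.mod_lt l hr
  have h1 : l % r + partner r a (l % r) + 1 ≡ a [MOD r] := add_partner_modEq hl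
  have h2 : l + partner r a (l % r) + 1 ≡ a [MOD r] :=
    (((Nat.mod_modEq l r).symm.add_right _).add_right _).trans h1
  constructor
  · intro h
    have h3 : l + k + 1 ≡ l + partner r a (l % r) + 1 [MOD r] := h.trans h2.symm
    have h4 : k ≡ partner r a (l % r) [MOD r] :=
      Nat.ModEq.add_left_cancel' l (Nat.ModEq.add_right_cancel' 1 h3)
    rw [Nat.ModEq, Nat.mod_eq_of_lt (partner_lt ha hl)] at h4
    exact h4
  · intro h
    have h4 : k ≡ partner r a (l % r) [MOD r] := by
      rw [Nat.ModEq, Nat.mod_eq_of_lt (partner_lt ha hl), h]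
    exact ((h4.add_left l).add_right 1).trans h2

lemma add_mul_lt_iff {r N c q : ℕ} (hc : c < r) : c + r * q < N ↔ q < classSize r N c := by
  have h1 := Nat.div_add_mod N r
  have h2 := Nat.mod_lt N (show 0 < r by omega)
  unfold classSize
  rcases lt_trichotomy q (N / r) with h | h | h
  · have h3 : r * (q + 1) ≤ r * (N / r) := Nat.mul_le_mul_left r h
    rw [Nat.mul_add, Nat.mul_one] at h3
    constructor
    · intro; omega
    · intro; omega
  · subst h
    split_ifs <;> omega
  · have h3 : r * (N / r + 1) ≤ r * q := Nat.mul_le_mul_left r h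
    rw [Nat.mul_add, Nat.mul_one] at h3
    split_ifs <;> omega

lemma mod_eq_zero_or {r a N : ℕ} (ha : a < r) (hN : N ≡ 0 [MOD r] ∨ N ≡ a [MOD r]) :
    N % r = 0 ∨ N % r = a := by
  rcases hN with h | h
  · left; rw [Nat.ModEq, Nat.zero_mod] at h; exact h
  · right; rw [Nat.ModEq, Nat.mod_eq_of_lt ha] at h; exact h

lemma classSize_partner {r a N c : ℕ} (ha : a < r) (hc : c < r)
    (hN : N ≡ 0 [MOD r] ∨ N ≡ a [MOD r]) : classSize r N (partner r a c) = classSize r N c := by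
  unfold classSize partner
  rcases mod_eq_zero_or ha hN with h | h <;> rw [h] <;> split_ifs <;> omega

lemma add_partner_mod_lt {r a N k : ℕ} (hr : 0 < r) (ha : a < r)
    (hN : N ≡ 0 [MOD r] ∨ N ≡ a [MOD r]) (hk : k < N) :
    partner r a (k % r) + r * (k / r) < N := by
  have hl := Nat.mod_lt k hr
  rw [add_mul_lt_iff (partner_lt ha hl), classSize_partner ha hl hN, ← add_mul_lt_iff hl,
    Nat.mod_add_div]
  exact hk

lemma add_mul_mod {r c q : ℕ} (hc : c < r) : (c + r * q) % r = c := by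
  rw [Nat.add_mul_mod_self_left, Nat.mod_eq_of_lt hc]

lemma add_mul_div {r c q : ℕ} (hc : c < r) : (c + r * q) / r = q := by
  rw [Nat.add_mul_div_left _ _ (by omega), Nat.div_eq_of_lt hc, zero_add]

/-- The involution of `0, …, N - 1` that maps each residue class to its partner. -/
def partnerPerm {r a N : ℕ} (hr : 0 < r) (ha : a < r)
    (hN : N ≡ 0 [MOD r] ∨ N ≡ a [MOD r]) : Equiv.Perm (Fin N) :=
  Function.Involutive.toPerm
    (fun k => ⟨partner r a (k % r) + r * (k / r), add_partner_mod_lt hr ha hN k.2⟩) (by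
      intro k
      have hl := Nat.mod_lt k hr
      ext
      simp only
      rw [add_mul_mod (partner_lt ha hl), add_mul_div (partner_lt ha hl), partner_partner ha hl,
        Nat.mod_add_div])

lemma partnerPerm_val {r a N : ℕ} (hr : 0 < r) (ha : a < r)
    (hN : N ≡ 0 [MOD r] ∨ N ≡ a [MOD r]) (k : Fin N) :
    (partnerPerm hr ha hN k : ℕ) = partner r a (k % r) + r * (k / r) := rfl

/-- The residue of an element of `Fin N`. -/
def finMod {r N : ℕ} (hr : 0 < r) (i : Fin N) : Fin r := ⟨i % r, Nat.mod_lt _ hr⟩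

/-- The elements of a residue class, in increasing order. -/
def classEquiv {r : ℕ} (N : ℕ) (hr : 0 < r) (c : Fin r) :
    Fin (classSize r N c) ≃ {i : Fin N // finMod hr i = c} where
  toFun q := ⟨⟨c + r * q, (add_mul_lt_iff c.2).2 q.2⟩, Fin.ext (add_mul_mod c.2)⟩
  invFun i := ⟨i.1 / r, by
    have h : (i.1 : ℕ) % r = c := congrArg Fin.val i.2
    rw [← add_mul_lt_iff c.2, ← h, Nat.mod_add_div]
    exact i.1.2⟩
  left_inv q := Fin.ext (add_mul_div c.2)
  right_inv i := by
    have h : (i.1 : ℕ) % r = c := congrArg Fin.val i.2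
    ext
    simp only
    rw [← h, Nat.mod_add_div]

lemma classEquiv_val {r N : ℕ} (hr : 0 < r) (c : Fin r) (q : Fin (classSize r N c)) :
    (((classEquiv N hr c q) : Fin N) : ℕ) = c + r * q := rfl

lemma classEquiv_lt_iff {r N : ℕ} (hr : 0 < r) (c : Fin r) (q q' : Fin (classSize r N c)) :
    ((classEquiv N hr c q) : Fin N) < (classEquiv N hr c q') ↔ q < q' := by
  rw [Fin.lt_def, classEquiv_val, classEquiv_val, Fin.lt_def, Nat.add_lt_add_iff_left,
    Nat.mul_lt_mul_left hr]

lemma sum_ite_mod_eq {r N : ℕ} (hr : 0 < r) (c : Fin r) :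
    ∑ i : Fin N, (if (i : ℕ) % r = c then 1 else 0 : ℕ) = classSize r N c := by
  rw [← card_filter, ← Fintype.card_subtype]
  have e : {i : Fin N // (i : ℕ) % r = c} ≃ {i : Fin N // finMod hr i = c} :=
    Equiv.subtypeEquivRight fun i => by simp [finMod, Fin.ext_iff]
  rw [Fintype.card_congr (e.trans (classEquiv N hr c).symm), Fintype.card_fin]

/-- The residues `0, …, N - 1` can be matched with their partners only if `N ≡ 0` or `N ≡ a`. -/
lemma modEq_of_perm_partner {r a N : ℕ} (hr : 0 < r) (ha : a < r) (ρ : Equiv.Perm (Fin N))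
    (hρ : ∀ i, (ρ i : ℕ) % r = partner r a (i % r)) : N ≡ 0 [MOD r] ∨ N ≡ a [MOD r] := by
  have h : ∀ c, c < r → classSize r N c = classSize r N (partner r a c) := by
    intro c hc
    have h1 := (exists_perm_iff_sum_eq (fun i : Fin N => (i : ℕ) % r)
      (fun i : Fin N => partner r a (i % r))).1 ⟨ρ, hρ⟩ c
    rw [← sum_ite_mod_eq hr ⟨c, hc⟩, ← sum_ite_mod_eq hr ⟨partner r a c, partner_lt ha hc⟩]
    simp only at h1 ⊢
    rw [h1]
    refine sum_congr rfl fun i _ => ?_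
    have hi := Nat.mod_lt (i : ℕ) hr
    congr 1
    refine propext ⟨fun h => ?_, fun h => ?_⟩
    · rw [← h, partner_partner ha hi]
    · rw [h, partner_partner ha hc]
  have hs := Nat.mod_lt N hr
  have h1 := h a ha
  have h0 := h 0 hr
  unfold classSize partner at h1 h0
  have key : N % r = 0 ∨ N % r = a := by
    split_ifs at h1 h0 <;> omega
  rcases key with h | h
  · left; rw [Nat.ModEq, Nat.zero_mod, h]
  · right; rw [Nat.ModEq, Nat.mod_eq_of_lt ha, h]

lemma prod_same_class {M : Type*} [CommMonoid M] {r N : ℕ} (hr : 0 < r) (F : Fin N → Fin N → M) :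
    ∏ i, ∏ j ∈ Ioi i, (if finMod hr i = finMod hr j then F i j else 1) =
      ∏ c : Fin r, ∏ q, ∏ q' ∈ Ioi q, F (classEquiv N hr c q) (classEquiv N hr c q') := by
  rw [← Fintype.prod_fiberwise (finMod hr)]
  refine prod_congr rfl fun c _ => ?_
  rw [← Equiv.prod_comp (classEquiv N hr c)]
  refine prod_congr rfl fun q _ => ?_
  have e1 : ∀ G : Fin (classSize r N c) → M, ∏ q' ∈ Ioi q, G q' =
      ∏ q', if q < q' then G q' else 1 := fun G => by
    rw [← prod_filter]; refine prod_congr (by ext; simp) fun _ _ => rfl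
  have e2 : ∀ (i : Fin N) (G : Fin N → M), ∏ j ∈ Ioi i, G j =
      ∏ j, if i < j then G j else 1 := fun i G => by
    rw [← prod_filter]; refine prod_congr (by ext; simp) fun _ _ => rfl
  rw [e1, e2, (classEquiv N hr c q).2]
  have e3 : ∀ G : Fin N → M, ∏ j, (if c = finMod hr j then G j else 1) =
      ∏ q', G (classEquiv N hr c q') := fun G => by
    rw [Equiv.prod_comp (classEquiv N hr c) (fun j => G j), ← prod_filter]
    exact prod_subtype _ (by simp [eq_comm]) _
  have e4 : ∀ j, (if ((classEquiv N hr c q) : Fin N) < j then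
      (if c = finMod hr j then F (classEquiv N hr c q) j else 1) else 1) =
      if c = finMod hr j then
        (if ((classEquiv N hr c q) : Fin N) < j then F (classEquiv N hr c q) j else 1) else 1 :=
    fun j => by split_ifs <;> rfl
  simp_rw [e4]
  rw [e3]
  simp_rw [classEquiv_lt_iff]

/-! ### The determinant of a block -/

/-- The polynomials `(α + x)_q (α + γ + x + q)_{n - 1 - q}`. -/
def blockPoly (n : ℕ) (α γ : ℂ) (q : ℕ) : Polynomial ℂ :=
  (∏ t ∈ range q, (Polynomial.X + Polynomial.C (α + t))) *
    ∏ t ∈ range (n - 1 - q), (Polynomial.X + Polynomial.C (α + γ + q + t))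

lemma blockPoly_natDegree_lt {n : ℕ} (α γ : ℂ) (q : Fin n) :
    (blockPoly n α γ q).natDegree < n := by
  refine lt_of_le_of_lt Polynomial.natDegree_mul_le ?_
  rw [Polynomial.natDegree_prod_of_monic _ _ fun t _ => Polynomial.monic_X_add_C _,
    Polynomial.natDegree_prod_of_monic _ _ fun t _ => Polynomial.monic_X_add_C _]
  simp only [Polynomial.natDegree_X_add_C, sum_const, card_range, smul_eq_mul, mul_one]
  have := q.2
  omega

lemma eval_blockPoly (n : ℕ) (α γ : ℂ) (q : ℕ) (x : ℂ) :
    (blockPoly n α γ q).eval x =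
      (∏ t ∈ range q, (x + (α + t))) * ∏ t ∈ range (n - 1 - q), (x + (α + γ + q + t)) := by
  simp [blockPoly, Polynomial.eval_prod]

theorem exists_det_blockPoly (n : ℕ) (α γ : ℂ) (hγ : 0 < γ.re) :
    ∃ K : ℂ, K ≠ 0 ∧ ∀ p : Fin n → ℂ,
      Matrix.det (Matrix.of fun i q : Fin n => (blockPoly n α γ q).eval (p i)) =
        K * ∏ i, ∏ j ∈ Ioi i, (p j - p i) := by
  set C : Matrix (Fin n) (Fin n) ℂ := Matrix.of fun k q => (blockPoly n α γ q).coeff k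
  have hdet : ∀ p : Fin n → ℂ,
      Matrix.det (Matrix.of fun i q : Fin n => (blockPoly n α γ q).eval (p i)) =
        C.det * ∏ i, ∏ j ∈ Ioi i, (p j - p i) := by
    intro p
    have : (Matrix.of fun i q : Fin n => (blockPoly n α γ q).eval (p i)) =
        Matrix.vandermonde p * C := by
      ext i q
      rw [Matrix.of_apply, Matrix.mul_apply,
        Polynomial.eval_eq_sum_range' (blockPoly_natDegree_lt α γ q),
        ← Fin.sum_univ_eq_sum_range (fun k => (blockPoly n α γ q).coeff k * p i ^ k)]
      refine sum_congr rfl fun k _ => ?_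
      rw [Matrix.vandermonde_apply, mul_comm]
      rfl
    rw [this, Matrix.det_mul, Matrix.det_vandermonde, mul_comm]
  refine ⟨C.det, fun h0 => ?_, hdet⟩
  have h1 := hdet fun i => -α - (i : ℕ)
  rw [h0, zero_mul, Matrix.det_of_isLowerTriangular] at h1
  · rw [prod_eq_zero_iff] at h1
    obtain ⟨i, -, hi⟩ := h1
    rw [Matrix.of_apply, eval_blockPoly, mul_eq_zero, prod_eq_zero_iff, prod_eq_zero_iff] at hi
    rcases hi with ⟨t, ht, h⟩ | ⟨t, ht, h⟩
    · have : ((t : ℕ) : ℂ) = (i : ℕ) := by linear_combination h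
      have : t = i := by exact_mod_cast this
      have := mem_range.1 ht
      omega
    · have : γ + (t : ℂ) = 0 := by linear_combination h
      have := congrArg Complex.re this
      simp at this
      have ht0 : (0 : ℝ) ≤ t := Nat.cast_nonneg t
      linarith
  · intro i j hij
    have hij : (i : ℕ) < j := by simpa using hij
    rw [Matrix.of_apply, eval_blockPoly]
    refine mul_eq_zero_of_left (prod_eq_zero (mem_range.2 hij) ?_) _
    ring

end Residues

section Determinants

open Finset

/-! ### Brackets and the Gamma factors -/

/-- The ratio of bracket products attached to the beta number `m`. -/
def bracketRatio (r a N : ℕ) (u v : ℂ) (m : ℕ) : ℂ :=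
  ∏ n ∈ Icc 1 m, (bracket r a (n : ℤ) ((r : ℂ) * u) /
    bracket r a ((N : ℤ) + n) ((r : ℂ) * u + (r : ℂ) * v))

lemma bracket_ne_zero {r a : ℕ} {n : ℤ} {y : ℂ}
    (h : n ≡ (a : ℤ) [ZMOD (r : ℤ)] → 0 < (n : ℝ) + y.re) : bracket r a n y ≠ 0 := by
  unfold bracket
  split_ifs with hn
  · intro h0
    have := congrArg Complex.re h0
    simp at this
    linarith [h hn]
  · exact one_ne_zero

lemma mul_re_gt {r : ℕ} (hr : 0 < r) {u : ℂ} (hu : -1 / (r : ℝ) < u.re) :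
    -1 < (r : ℝ) * u.re := by
  have hrp : (0 : ℝ) < r := by exact_mod_cast hr
  rw [div_lt_iff₀ hrp] at hu
  linarith

lemma bracket_numerator_ne_zero {r : ℕ} (a : ℕ) (hr : 0 < r) {u : ℂ} (hu : -1 / (r : ℝ) < u.re)
    {n : ℕ} (hn : 1 ≤ n) : bracket r a (n : ℤ) ((r : ℂ) * u) ≠ 0 := by
  refine bracket_ne_zero fun _ => ?_
  have h1 := mul_re_gt hr hu
  have h2 : (1 : ℝ) ≤ n := by exact_mod_cast hn
  simp
  linarith

lemma bracket_denominator_ne_zero {r a N : ℕ} (hr : 0 < r) (ha : a < r)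
    (hN : N ≡ 0 [MOD r] ∨ N ≡ a [MOD r]) (hN0 : 0 < N) {u v : ℂ}
    (hu : -1 / (r : ℝ) < u.re) (hv : -1 < v.re) {n : ℕ} (hn : 1 ≤ n) :
    bracket r a ((N : ℤ) + n) ((r : ℂ) * u + (r : ℂ) * v) ≠ 0 := by
  refine bracket_ne_zero fun h => ?_
  have h1 := mul_re_gt hr hu
  have hrp : (0 : ℝ) < r := by exact_mod_cast hr
  have h2 : -(r : ℝ) < r * v.re := by nlinarith
  have h3 : r + 1 ≤ N + n := by
    have h' : N + n ≡ a [MOD r] := by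
      rw [← Int.natCast_modEq_iff]; exact_mod_cast h
    rcases Nat.lt_or_ge N r with hlt | hge
    · rcases mod_eq_zero_or ha hN with h0 | h0
      · rw [Nat.mod_eq_of_lt hlt] at h0; omega
      · rw [Nat.mod_eq_of_lt hlt] at h0
        rw [h0] at h'
        have h4 : n ≡ 0 [MOD r] := Nat.ModEq.add_left_cancel' a h'
        have := Nat.le_of_dvd (by omega) ((Nat.modEq_zero_iff_dvd).1 h4)
        omega
    · omega
  have h4 : (r : ℝ) + 1 ≤ N + n := by exact_mod_cast h3
  simp
  linarith

lemma prod_bracket_period {r a : ℕ} (s : ℤ) (m n₀ : ℕ) (y : ℂ) (h1 : m < n₀)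
    (h2 : n₀ ≤ m + r) (h : s + n₀ ≡ (a : ℤ) [ZMOD (r : ℤ)]) :
    ∏ n ∈ Ioc m (m + r), bracket r a (s + n) y = ((s + n₀ : ℤ) : ℂ) + y := by
  rw [prod_eq_single_of_mem n₀ (mem_Ioc.2 ⟨h1, h2⟩)]
  · rw [bracket, if_pos h]
  · intro n hn hne
    rw [bracket, if_neg]
    intro h'
    apply hne
    have h3 : (n : ℤ) ≡ n₀ [ZMOD r] := Int.ModEq.add_left_cancel' s (h'.trans h.symm)
    have h4 := mem_Ioc.1 hn
    have h5 : n ≡ n₀ [MOD r] := Int.natCast_modEq_iff.1 h3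
    rcases le_total n n₀ with hle | hle
    · have h6 := (Nat.modEq_iff_dvd' hle).1 h5
      by_contra hcon
      have := Nat.le_of_dvd (by omega) h6
      omega
    · have h6 := (Nat.modEq_iff_dvd' hle).1 h5.symm
      by_contra hcon
      have := Nat.le_of_dvd (by omega) h6
      omega

/-- The shift of the Gamma functions in the residue class `c`. -/
def gammaShift (r a : ℕ) (u : ℂ) (c : ℕ) : ℂ := ((c : ℂ) + (partner r a c : ℂ) + 1) / r + u

lemma gammaShift_re_pos {r : ℕ} (a : ℕ) (hr : 0 < r) {u : ℂ} (hu : -1 / (r : ℝ) < u.re) (c : ℕ) :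
    0 < (gammaShift r a u c).re := by
  have : (gammaShift r a u c).re = ((c : ℝ) + partner r a c + 1) / r + u.re := by
    rw [gammaShift, Complex.add_re, Complex.div_natCast_re]; simp
  rw [this]
  have : (1 : ℝ) / r ≤ ((c : ℝ) + partner r a c + 1) / r := by
    gcongr
    have h1 : (0 : ℝ) ≤ c := Nat.cast_nonneg c
    have h2 : (0 : ℝ) ≤ partner r a c := Nat.cast_nonneg _
    linarith
  rw [neg_div] at hu
  linarith

/-- The Gamma factor of the beta number `c + r * p`. -/
def gammaFactor (r a N : ℕ) (u v : ℂ) (c p : ℕ) : ℂ :=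
  Complex.Gamma (gammaShift r a u c + p) /
    Complex.Gamma (gammaShift r a u c + (v + 1) + p + (classSize r N c - 1 : ℕ))

lemma Gamma_add_nat {s : ℂ} (hs : 0 < s.re) (q : ℕ) :
    Complex.Gamma (s + q) = (∏ t ∈ range q, (s + t)) * Complex.Gamma s := by
  induction q with
  | zero => simp
  | succ q ih =>
    have : s + (q : ℂ) ≠ 0 := fun h => by
      have := congrArg Complex.re h
      simp at this
      have hq : (0 : ℝ) ≤ q := Nat.cast_nonneg q
      linarith
    rw [Nat.cast_succ, ← add_assoc, Complex.Gamma_add_one _ this, ih, prod_range_succ]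
    ring

lemma Gamma_ratio_eq_blockPoly {n q : ℕ} (hq : q < n) {α γ : ℂ} (hα : 0 < α.re) (hγ : 0 < γ.re)
    (p : ℕ) : Complex.Gamma (α + p + q) / Complex.Gamma (α + γ + p + q) =
      Complex.Gamma (α + p) / Complex.Gamma (α + γ + p + (n - 1 : ℕ)) *
        (blockPoly n α γ q).eval (p : ℂ) := by
  have hp : (0 : ℝ) ≤ p := Nat.cast_nonneg p
  have hq0 : (0 : ℝ) ≤ q := Nat.cast_nonneg q
  have h1 : 0 < (α + p).re := by simp; linarith
  have h2 : 0 < (α + γ + p + q).re := by simp; linarith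
  have h3 : α + γ + p + (n - 1 : ℕ) = α + γ + p + q + (n - 1 - q : ℕ) := by
    rw [add_assoc _ (q : ℂ), ← Nat.cast_add, show q + (n - 1 - q) = n - 1 by omega]
  have h4 : 0 < (α + γ + p + (n - 1 : ℕ)).re := by
    rw [h3, Complex.add_re, Complex.natCast_re]; positivity
  have g1 := Complex.Gamma_ne_zero_of_re_pos h2
  have g2 := Complex.Gamma_ne_zero_of_re_pos h4
  rw [div_mul_eq_mul_div, div_eq_div_iff g1 g2, h3, Gamma_add_nat h1, Gamma_add_nat h2,
    eval_blockPoly]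
  have e1 : ∀ t : ℕ, α + p + (t : ℂ) = p + (α + t) := fun t => by ring
  have e2 : ∀ t : ℕ, α + γ + p + q + (t : ℂ) = p + (α + γ + q + t) := fun t => by ring
  simp_rw [e1, e2]
  ring

lemma moment_of_class {r a N : ℕ} (hr : 0 < r) (ha : a < r) {u v : ℂ}
    (hu : -1 / (r : ℝ) < u.re) (hv : -1 < v.re) {c p q : ℕ} (hc : c < r)
    (hq : q < classSize r N c) :
    moment r a u v (c + r * p + (partner r a c + r * q)) =
      1 / (2 * (Real.pi : ℂ)) * Complex.Gamma (v + 1) * gammaFactor r a N u v c p *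
        (blockPoly (classSize r N c) (gammaShift r a u c) (v + 1) q).eval (p : ℂ) := by
  have hr0 : (r : ℂ) ≠ 0 := by exact_mod_cast hr.ne'
  rw [moment_eq hr a u v hu hv, if_pos]
  · have e : (((c + r * p + (partner r a c + r * q) : ℕ) : ℂ) + 1) / r + u =
        gammaShift r a u c + p + q := by
      rw [gammaShift]; push_cast; field_simp; ring
    have e' : gammaShift r a u c + p + q + (v + 1) = gammaShift r a u c + (v + 1) + p + q := by
      ring
    rw [e, e', mul_div_right_comm, Gamma_ratio_eq_blockPoly hq (gammaShift_re_pos a hr hu c)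
      (by simp; linarith), gammaFactor]
    ring
  · rw [add_modEq_iff_partner hr ha, add_mul_mod hc, add_mul_mod (partner_lt ha hc)]

lemma gammaFactor_ne_zero {r : ℕ} (a N : ℕ) (hr : 0 < r) {u v : ℂ}
    (hu : -1 / (r : ℝ) < u.re) (hv : -1 < v.re) (c p : ℕ) : gammaFactor r a N u v c p ≠ 0 := by
  have h := gammaShift_re_pos a hr hu c
  have hp : (0 : ℝ) ≤ p := Nat.cast_nonneg p
  have hn : (0 : ℝ) ≤ (classSize r N c - 1 : ℕ) := Nat.cast_nonneg _
  refine div_ne_zero (Complex.Gamma_ne_zero_of_re_pos ?_) (Complex.Gamma_ne_zero_of_re_pos ?_)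
  · simp; linarith
  · rw [Complex.add_re, Complex.natCast_re]; simp only [Complex.add_re, Complex.natCast_re,
      Complex.one_re]; linarith

lemma gammaFactor_succ {r : ℕ} (a N : ℕ) (hr : 0 < r) {u v : ℂ}
    (hu : -1 / (r : ℝ) < u.re) (hv : -1 < v.re) (c p : ℕ) :
    gammaFactor r a N u v c (p + 1) = gammaFactor r a N u v c p *
      ((gammaShift r a u c + p) /
        (gammaShift r a u c + (v + 1) + p + (classSize r N c - 1 : ℕ))) := by
  have h := gammaShift_re_pos a hr hu c
  have hp : (0 : ℝ) ≤ p := Nat.cast_nonneg p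
  have hn : (0 : ℝ) ≤ (classSize r N c - 1 : ℕ) := Nat.cast_nonneg _
  have h1 : gammaShift r a u c + p ≠ 0 := fun h0 => by
    have := congrArg Complex.re h0
    simp only [Complex.add_re, Complex.natCast_re, Complex.zero_re] at this
    linarith
  have h2 : gammaShift r a u c + (v + 1) + p + (classSize r N c - 1 : ℕ) ≠ 0 := fun h0 => by
    have := congrArg Complex.re h0
    simp only [Complex.add_re, Complex.natCast_re, Complex.zero_re, Complex.one_re] at this
    linarith
  rw [gammaFactor, gammaFactor, Nat.cast_succ, ← add_assoc, Complex.Gamma_add_one _ h1,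
    show gammaShift r a u c + (v + 1) + (↑p + 1) + (classSize r N c - 1 : ℕ) =
      gammaShift r a u c + (v + 1) + p + (classSize r N c - 1 : ℕ) + 1 by ring,
    Complex.Gamma_add_one _ h2, mul_div_mul_comm, mul_comm]

lemma prod_Icc_one_add {M : Type*} [CommMonoid M] (f : ℕ → M) (m k : ℕ) :
    ∏ n ∈ Icc 1 (m + k), f n = (∏ n ∈ Icc 1 m, f n) * ∏ n ∈ Ioc m (m + k), f n := by
  have e : ∀ m : ℕ, Icc 1 m = Ioc 0 m := fun m => by ext; simp [Nat.succ_le_iff]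
  rw [e, e, prod_Ioc_consecutive f (Nat.zero_le m) (Nat.le_add_right m k)]

lemma bracketRatio_add {r a N : ℕ} (hr : 0 < r) (ha : a < r)
    (hN : N ≡ 0 [MOD r] ∨ N ≡ a [MOD r]) (u v : ℂ) {c : ℕ}
    (hc : c < r) (hn : 0 < classSize r N c) (p : ℕ) :
    bracketRatio r a N u v (c + r * (p + 1)) = bracketRatio r a N u v (c + r * p) *
      ((gammaShift r a u c + p) /
        (gammaShift r a u c + (v + 1) + p + (classSize r N c - 1 : ℕ))) := by
  have hr0 : (r : ℂ) ≠ 0 := by exact_mod_cast hr.ne'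
  have hpc := partner_lt ha hc
  have hcs := classSize_partner ha hc hN
  have hmod : c + partner r a c + 1 ≡ a [MOD r] := add_partner_modEq hc
  set c' := partner r a c with hc'
  set n := classSize r N c with hnn
  have hlo : N ≤ c' + r * n := by
    by_contra! h
    rw [add_mul_lt_iff hpc, hcs] at h
    omega
  have hhi : c' + r * n < N + r := by
    have h1 : c' + r * (n - 1) < N := by
      rw [add_mul_lt_iff hpc, hcs]; omega
    have h2 : r * n = r * (n - 1) + r := by
      rw [← Nat.mul_succ]; congr 1; omega
    omega
  have hshift : ∀ k : ℕ, ((c + c' + 1 + r * k : ℕ) : ℤ) ≡ (a : ℤ) [ZMOD r] := by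
    intro k
    rw [Int.natCast_modEq_iff]
    exact (Nat.add_modEq_left_iff.2 (dvd_mul_right r k)).trans hmod
  have hP1 := prod_bracket_period (r := r) (a := a) 0 (c + r * p) (c + r * p + c' + 1) ((r : ℂ) * u) (by omega)
    (by omega) (by
      have := hshift p
      rw [show ((0 : ℤ) + ((c + r * p + c' + 1 : ℕ) : ℤ)) = ((c + c' + 1 + r * p : ℕ) : ℤ) by
        push_cast; ring]
      exact this)
  have hP2 := prod_bracket_period (r := r) (a := a) (N : ℤ) (c + r * p) (c + c' + 1 + r * p + r * n - N)
    ((r : ℂ) * u + (r : ℂ) * v) (by omega) (by omega) (by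
      have := hshift (p + n)
      rw [show ((N : ℤ) + ((c + c' + 1 + r * p + r * n - N : ℕ) : ℤ)) =
        ((c + c' + 1 + r * (p + n) : ℕ) : ℤ) by
          rw [Nat.cast_sub (by omega)]; push_cast; ring]
      exact this)
  rw [bracketRatio, Nat.mul_succ, ← add_assoc, prod_Icc_one_add, ← bracketRatio]
  congr 1
  rw [prod_div_distrib, hP2]
  simp only [zero_add] at hP1
  rw [hP1]
  have e1 : (((c + r * p + c' + 1 : ℕ) : ℤ) : ℂ) + (r : ℂ) * u = r * (gammaShift r a u c + p) := by
    rw [gammaShift]; push_cast; field_simp; ring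
  have e2 : (((N : ℤ) + ((c + c' + 1 + r * p + r * n - N : ℕ) : ℤ) : ℤ) : ℂ) +
      ((r : ℂ) * u + (r : ℂ) * v) =
      r * (gammaShift r a u c + (v + 1) + p + (n - 1 : ℕ)) := by
    rw [gammaShift, Nat.cast_sub (by omega), Nat.cast_sub hn]; push_cast; field_simp; ring
  rw [e1, e2, mul_div_mul_left _ _ hr0]

lemma bracketRatio_ne_zero {r a N : ℕ} (hr : 0 < r) (ha : a < r)
    (hN : N ≡ 0 [MOD r] ∨ N ≡ a [MOD r]) (hN0 : 0 < N) {u v : ℂ}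
    (hu : -1 / (r : ℝ) < u.re) (hv : -1 < v.re) (m : ℕ) : bracketRatio r a N u v m ≠ 0 :=
  prod_ne_zero_iff.2 fun _ hn => div_ne_zero
    (bracket_numerator_ne_zero a hr hu (mem_Icc.1 hn).1)
    (bracket_denominator_ne_zero hr ha hN hN0 hu hv (mem_Icc.1 hn).1)

lemma gammaFactor_eq_bracketRatio {r a N : ℕ} (hr : 0 < r) (ha : a < r)
    (hN : N ≡ 0 [MOD r] ∨ N ≡ a [MOD r]) (hN0 : 0 < N) {u v : ℂ}
    (hu : -1 / (r : ℝ) < u.re) (hv : -1 < v.re) {c : ℕ} (hc : c < r)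
    (hn : 0 < classSize r N c) (p : ℕ) :
    gammaFactor r a N u v c p =
      gammaFactor r a N u v c 0 / bracketRatio r a N u v c * bracketRatio r a N u v (c + r * p) := by
  induction p with
  | zero => rw [mul_zero, add_zero, div_mul_cancel₀ _ (bracketRatio_ne_zero hr ha hN hN0 hu hv c)]
  | succ p ih =>
    rw [gammaFactor_succ a N hr hu hv, bracketRatio_add hr ha hN u v hc hn, ih]
    ring

/-! ### Evaluation of the moment determinants -/

/-- The antisymmetric two-point factor. -/
def pairFactor (r : ℕ) (l l' : ℕ) : ℂ :=
  if l % r = l' % r then (l : ℂ) - l' else if l % r < l' % r then -1 else 1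

lemma pairFactor_antisymm (r l l' : ℕ) : pairFactor r l l' = -pairFactor r l' l := by
  unfold pairFactor
  rcases lt_trichotomy (l % r) (l' % r) with h | h | h
  · rw [if_neg h.ne, if_pos h, if_neg h.ne', if_neg (by omega)]
  · rw [if_pos h, if_pos h.symm]; ring
  · rw [if_neg h.ne', if_neg (by omega), if_neg h.ne, if_pos h, neg_neg]

lemma sign_ne_zero_complex {N : ℕ} (σ : Equiv.Perm (Fin N)) : ((σ.sign : ℤ) : ℂ) ≠ 0 := by
  exact_mod_cast (σ.sign).ne_zero

/-- The evaluation when the beta numbers are matched with the indices. -/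
lemma exists_det_moment_matched {r a N : ℕ} (hr : 0 < r) (ha : a < r)
    (hN : N ≡ 0 [MOD r] ∨ N ≡ a [MOD r]) {u v : ℂ}
    (hu : -1 / (r : ℝ) < u.re) (hv : -1 < v.re) :
    ∃ K : ℂ, K ≠ 0 ∧ ∀ l : Fin N → ℕ, (∀ i, l i % r = (i : ℕ) % r) →
      Matrix.det (Matrix.of fun i j : Fin N =>
        moment r a u v (l i + (partnerPerm hr ha hN j : ℕ))) =
        K * (∏ i, bracketRatio r a N u v (l i)) *
          ∏ i, ∏ j ∈ Ioi i, pairFactor r (l i) (l j) := by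
  have hr0 : (r : ℂ) ≠ 0 := by exact_mod_cast hr.ne'
  have hγ : 0 < (v + 1).re := by simp; linarith
  choose K hK0 hK using fun c : Fin r =>
    exists_det_blockPoly (classSize r N c) (gammaShift r a u c) (v + 1) hγ
  set κ : ℂ := 1 / (2 * (Real.pi : ℂ)) * Complex.Gamma (v + 1) with hκ
  have hκ0 : κ ≠ 0 := by
    have : (Real.pi : ℂ) ≠ 0 := by exact_mod_cast Real.pi_ne_zero
    exact mul_ne_zero (one_div_ne_zero (mul_ne_zero two_ne_zero this))
      (Complex.Gamma_ne_zero_of_re_pos hγ)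
  set w : ℕ → ℂ := fun c => gammaFactor r a N u v c 0 / bracketRatio r a N u v c with hw
  set S : ℂ := ∏ i : Fin N, ∏ j ∈ Ioi i, (if finMod hr i = finMod hr j then -(r : ℂ) else
    if (i : ℕ) % r < (j : ℕ) % r then -1 else 1) with hS
  have hS0 : S ≠ 0 := by
    refine prod_ne_zero_iff.2 fun i _ => prod_ne_zero_iff.2 fun j _ => ?_
    split_ifs
    · exact neg_ne_zero.2 hr0
    · exact neg_ne_zero.2 one_ne_zero
    · exact one_ne_zero
  have hclass : ∀ i : Fin N, (i : ℕ) / r < classSize r N ((i : ℕ) % r) := fun i => by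
    rw [← add_mul_lt_iff (Nat.mod_lt _ hr), Nat.mod_add_div]; exact i.2
  refine ⟨(∏ i : Fin N, κ * w ((i : ℕ) % r)) * (∏ c, K c) / S, ?_, fun l hl => ?_⟩
  · refine div_ne_zero (mul_ne_zero (prod_ne_zero_iff.2 fun i _ => mul_ne_zero hκ0 ?_)
      (prod_ne_zero_iff.2 fun c _ => hK0 c)) hS0
    exact div_ne_zero (gammaFactor_ne_zero a N hr hu hv _ _)
      (bracketRatio_ne_zero hr ha hN (Nat.zero_lt_of_lt i.2) hu hv _)
  have hdecomp : ∀ i, l i = (i : ℕ) % r + r * (l i / r) := fun i => by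
    rw [← hl i, Nat.mod_add_div]
  set B : Matrix (Fin N) (Fin N) ℂ := Matrix.of fun i j => if finMod hr i = finMod hr j then
    (blockPoly (classSize r N ((i : ℕ) % r)) (gammaShift r a u ((i : ℕ) % r)) (v + 1)
      ((j : ℕ) / r)).eval ((l i / r : ℕ) : ℂ) else 0 with hB
  have hM : (Matrix.of fun i j : Fin N =>
      moment r a u v (l i + (partnerPerm hr ha hN j : ℕ))) =
      Matrix.of fun i j : Fin N => (κ * w ((i : ℕ) % r) * bracketRatio r a N u v (l i)) * B i j := by
    ext i j
    have hi := Nat.mod_lt (i : ℕ) hr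
    have hj := Nat.mod_lt (j : ℕ) hr
    simp only [Matrix.of_apply, hB, partnerPerm_val]
    split_ifs with h
    · have h' : (i : ℕ) % r = (j : ℕ) % r := congrArg Fin.val h
      have hm := moment_of_class (N := N) (p := l i / r) (q := (j : ℕ) / r) hr ha hu hv hi (by
        rw [h']; exact hclass j)
      rw [← hdecomp] at hm
      rw [← h', hm, gammaFactor_eq_bracketRatio hr ha hN (Nat.zero_lt_of_lt i.2) hu hv hi
        (Nat.zero_lt_of_lt (hclass i)), ← hdecomp, hκ]
      ring
    · rw [mul_zero, moment_eq hr a u v hu hv, if_neg]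
      rw [add_modEq_iff_partner hr ha, add_mul_mod (partner_lt ha hj), hl]
      intro h'
      apply h
      have := congrArg (partner r a) h'
      rw [partner_partner ha hj, partner_partner ha hi] at this
      exact Fin.ext this.symm
  have hBdet : B.det = (∏ c, K c) * ∏ i : Fin N, ∏ j ∈ Ioi i,
      (if finMod hr i = finMod hr j then ((l j / r : ℕ) : ℂ) - ((l i / r : ℕ) : ℂ) else 1) := by
    have htri : B.BlockTriangular (finMod hr) := fun i j hij => by
      rw [hB, Matrix.of_apply, if_neg hij.ne']
    rw [htri.det_fintype, prod_same_class hr fun i j => ((l j / r : ℕ) : ℂ) - ((l i / r : ℕ) : ℂ),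
      ← prod_mul_distrib]
    refine prod_congr rfl fun c _ => ?_
    rw [← hK c, ← Matrix.det_submatrix_equiv_self (classEquiv N hr c)]
    congr 1
    ext q q'
    have h1 := (classEquiv N hr c q).2
    have h2 := (classEquiv N hr c q').2
    have h3 : ((classEquiv N hr c q : Fin N) : ℕ) % r = c := congrArg Fin.val h1
    rw [Matrix.submatrix_apply, Matrix.toSquareBlock_def, Matrix.of_apply, hB, Matrix.of_apply,
      if_pos (h1.trans h2.symm), Matrix.of_apply, h3]
    congr 2
    rw [classEquiv_val, add_mul_div c.2]
  have hpair : ∏ i, ∏ j ∈ Ioi i, pairFactor r (l i) (l j) = S * ∏ i : Fin N, ∏ j ∈ Ioi i,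
      (if finMod hr i = finMod hr j then ((l j / r : ℕ) : ℂ) - ((l i / r : ℕ) : ℂ) else 1) := by
    rw [hS, ← prod_mul_distrib]
    refine prod_congr rfl fun i _ => ?_
    rw [← prod_mul_distrib]
    refine prod_congr rfl fun j _ => ?_
    rw [pairFactor, hl, hl]
    by_cases h : finMod hr i = finMod hr j
    · have h' : (i : ℕ) % r = (j : ℕ) % r := congrArg Fin.val h
      rw [if_pos h, if_pos h', if_pos h]
      have e : ∀ i, (l i : ℂ) = ((i : ℕ) % r : ℕ) + r * ((l i / r : ℕ) : ℂ) := fun i => by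
        exact_mod_cast congrArg (Nat.cast : ℕ → ℂ) (hdecomp i)
      rw [e i, e j, h']
      ring
    · have h' : ¬ (i : ℕ) % r = (j : ℕ) % r := fun h' => h (Fin.ext h')
      rw [if_neg h, if_neg h', if_neg h, mul_one]
  rw [hM, Matrix.det_mul_column, hBdet, hpair, prod_mul_distrib]
  field_simp

/-- The moment determinants are given by a product formula whenever the residues match. -/
theorem exists_det_moment {r a N : ℕ} (hr : 0 < r) (ha : a < r)
    (hN : N ≡ 0 [MOD r] ∨ N ≡ a [MOD r]) {u v : ℂ}
    (hu : -1 / (r : ℝ) < u.re) (hv : -1 < v.re) :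
    ∃ K : ℂ, K ≠ 0 ∧ ∀ l : Fin N → ℕ,
      (∃ σ : Equiv.Perm (Fin N), ∀ i, l (σ i) % r = (i : ℕ) % r) →
      Matrix.det (Matrix.of fun i j : Fin N => moment r a u v (l i + (N - 1 - (j : ℕ)))) =
        K * (∏ i, bracketRatio r a N u v (l i)) *
          ∏ i, ∏ j ∈ Ioi i, pairFactor r (l i) (l j) := by
  obtain ⟨K, hK0, hK⟩ := exists_det_moment_matched hr ha hN hu hv
  set π : Equiv.Perm (Fin N) := Fin.revPerm.trans (partnerPerm hr ha hN) with hπ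
  refine ⟨((π.sign : ℤ) : ℂ) * K, mul_ne_zero (sign_ne_zero_complex π) hK0, ?_⟩
  rintro l ⟨σ, hσ⟩
  have hσσ : ((σ.sign : ℤ) : ℂ) * ((σ.sign : ℤ) : ℂ) = 1 := by
    rw [← Int.cast_mul, ← Units.val_mul, Int.units_mul_self]; simp
  have h1 : (Matrix.of fun i j : Fin N => moment r a u v (l i + (N - 1 - (j : ℕ)))) =
      ((Matrix.of fun i j : Fin N =>
        moment r a u v (l (σ i) + (partnerPerm hr ha hN j : ℕ))).submatrix id π).submatrix
          σ.symm id := by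
    ext i j
    have : partnerPerm hr ha hN (π j) = Fin.rev j := by
      rw [hπ, Equiv.trans_apply, Fin.revPerm_apply]
      exact (Function.Involutive.toPerm_involutive _) _
    simp only [Matrix.submatrix_apply, Matrix.of_apply, id, Equiv.apply_symm_apply, this,
      Fin.val_rev]
    congr 2; omega
  have h2 := σ.prod_Ioi_comp_eq_sign_mul_prod (R := ℂ) (f := fun i j => pairFactor r (l i) (l j))
    fun i j => pairFactor_antisymm r _ _
  rw [h1, Matrix.det_permute, Matrix.det_permute', hK (fun i => l (σ i)) hσ, h2,
    Equiv.prod_comp σ fun i => bracketRatio r a N u v (l i), Equiv.Perm.sign_symm]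
  linear_combination (((π.sign : ℤ) : ℂ) * K * (∏ i, bracketRatio r a N u v (l i)) *
    ∏ i, ∏ j ∈ Ioi i, pairFactor r (l i) (l j)) * hσσ

/-- A nonvanishing moment determinant forces a matching of residues. -/
lemma exists_perm_of_det_ne_zero {r a N : ℕ} (hr : 0 < r) (ha : a < r) {u v : ℂ}
    (hu : -1 / (r : ℝ) < u.re) (hv : -1 < v.re) {l : Fin N → ℕ}
    (h : Matrix.det (Matrix.of fun i j : Fin N =>
      moment r a u v (l i + (N - 1 - (j : ℕ)))) ≠ 0) :
    ∃ σ : Equiv.Perm (Fin N), ∀ i, l (σ i) % r = partner r a ((i : ℕ) % r) := by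
  rw [Matrix.det_apply'] at h
  obtain ⟨σ, -, hσ⟩ := exists_ne_zero_of_sum_ne_zero h
  refine ⟨Fin.revPerm.trans σ, fun i => ?_⟩
  have h1 := prod_ne_zero_iff.1 (right_ne_zero_of_mul hσ) (Fin.rev i) (mem_univ _)
  rw [Matrix.of_apply, moment_eq hr a u v hu hv, Fin.val_rev] at h1
  have h2 : l (σ (Fin.rev i)) + (N - 1 - (N - (i + 1))) + 1 ≡ a [MOD r] := by
    by_contra hc
    exact h1 (if_neg hc)
  rw [show N - 1 - (N - ((i : ℕ) + 1)) = i by omega, add_comm (l _) (i : ℕ),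
    add_modEq_iff_partner hr ha] at h2
  exact h2

end Determinants

section Average

open Finset

/-! ### Signs -/

/-- The inclusion of the signs into the complex numbers. -/
def signHom : ℤˣ →* ℂ := (Int.castRingHom ℂ : ℤ →* ℂ).comp (Units.coeHom ℤ)

lemma signHom_mul_self (x : ℤˣ) : signHom x * signHom x = 1 := by
  rw [← map_mul, Int.units_mul_self, map_one]

lemma signHom_ne_zero (x : ℤˣ) : signHom x ≠ 0 := left_ne_zero_of_mul_eq_one (signHom_mul_self x)

lemma signHom_inv (x : ℤˣ) : (signHom x)⁻¹ = signHom x :=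
  inv_eq_of_mul_eq_one_left (signHom_mul_self x)

lemma sum_add_ediv {r : ℕ} (hr : 0 < r) (x : ℤ) : ∑ k ∈ range r, (x + k) / (r : ℤ) = x := by
  have hr0 : (r : ℤ) ≠ 0 := by exact_mod_cast hr.ne'
  have step : ∀ x : ℤ, ∑ k ∈ range r, (x + 1 + k) / (r : ℤ) =
      ∑ k ∈ range r, (x + k) / (r : ℤ) + 1 := by
    intro x
    have h1 := sum_range_succ (fun k : ℕ => (x + k) / (r : ℤ)) r
    have h2 := sum_range_succ' (fun k : ℕ => (x + k) / (r : ℤ)) r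
    simp only [Nat.cast_zero, add_zero, Int.add_ediv_of_dvd_right (dvd_refl (r : ℤ)),
      Int.ediv_self hr0] at h1 h2
    have h3 : ∀ k : ℕ, x + ((k + 1 : ℕ) : ℤ) = x + 1 + k := fun k => by push_cast; ring
    simp only [h3] at h2
    linarith
  induction x using Int.induction_on with
  | zero =>
    refine sum_eq_zero fun k hk => ?_
    rw [zero_add]
    exact Int.ediv_eq_zero_of_lt (by positivity) (by exact_mod_cast mem_range.1 hk)
  | succ i ih => rw [step, ih]
  | pred i ih =>
    have := step (-(i : ℤ) - 1)
    rw [sub_add_cancel, ih] at this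
    linarith

lemma prod_neg_one_zpow (s : Finset ℕ) (f : ℕ → ℤ) :
    ∏ k ∈ s, (-1 : ℤˣ) ^ f k = (-1) ^ ∑ k ∈ s, f k := by
  induction s using Finset.induction_on with
  | empty => simp
  | insert a s ha ih => rw [prod_insert ha, sum_insert ha, zpow_add, ih]

/-- The sign attached to the beta number `m`. -/
def floorSign (r N m : ℕ) : ℤˣ :=
  ∏ n ∈ Icc 1 m, (-1 : ℤˣ) ^ (((n : ℤ) - N) / (r : ℤ) + (n : ℤ) / (r : ℤ))

lemma floorSign_add {r : ℕ} (hr : 0 < r) (N m : ℕ) :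
    floorSign r N (m + r) = floorSign r N m * (-1) ^ N := by
  rw [floorSign, prod_Icc_one_add, ← floorSign]
  congr 1
  have e : ∀ f : ℕ → ℤˣ, ∏ n ∈ Ioc m (m + r), f n = ∏ k ∈ range r, f (m + 1 + k) := by
    intro f
    have : Ioc m (m + r) = Ico (m + 1) (m + 1 + r) := by ext; simp; omega
    rw [this, prod_Ico_eq_prod_range, Nat.add_sub_cancel_left]
  rw [e, prod_neg_one_zpow, sum_add_distrib]
  have h1 : ∀ k : ℕ, (((m + 1 + k : ℕ) : ℤ) - N) = ((m : ℤ) + 1 - N) + k := fun k => by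
    push_cast; ring
  have h2 : ∀ k : ℕ, ((m + 1 + k : ℕ) : ℤ) = ((m : ℤ) + 1) + k := fun k => by push_cast; ring
  simp_rw [h1, h2, sum_add_ediv hr]
  rw [show (m : ℤ) + 1 - N + (m + 1) = 2 * (m + 1) + -(N : ℤ) by ring, zpow_add, zpow_mul,
    zpow_neg, zpow_natCast]
  simp

lemma floorSign_eq {r : ℕ} (hr : 0 < r) (N m : ℕ) :
    floorSign r N m = floorSign r N (m % r) * (-1) ^ (N * (m / r)) := by
  have : ∀ p, floorSign r N (m % r + r * p) = floorSign r N (m % r) * (-1) ^ (N * p) := by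
    intro p
    induction p with
    | zero => simp
    | succ p ih => rw [Nat.mul_succ, ← add_assoc, floorSign_add hr, ih, Nat.mul_succ, pow_add,
        mul_assoc]
  have h := this (m / r)
  rwa [Nat.mod_add_div] at h

lemma prod_pairs {M : Type*} [CommMonoid M] {N : ℕ} (x : Fin N → M) :
    ∏ i, ∏ j ∈ Ioi i, x i * x j = ∏ i, x i ^ (N - 1) := by
  simp_rw [prod_mul_distrib]
  have h : ∏ i : Fin N, ∏ j ∈ Ioi i, x j = ∏ j : Fin N, ∏ i ∈ Iio j, x j :=
    prod_comm' (by simp)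
  rw [h, ← prod_mul_distrib]
  refine prod_congr rfl fun i _ => ?_
  rw [prod_const, prod_const, ← pow_add, Fin.card_Ioi, Fin.card_Iio]
  congr 1
  omega

/-- The factor contributed by a hook of length `n`. -/
def hookFactor (r : ℕ) (n : ℤ) : ℂ := signHom ((-1) ^ (n / (r : ℤ))) * bracket r 0 n 0

lemma bracket_zero_ne_zero (r : ℕ) {n : ℤ} (hn : 1 ≤ n) : bracket r 0 n 0 ≠ 0 := by
  refine bracket_ne_zero fun _ => ?_
  have : (1 : ℝ) ≤ n := by exact_mod_cast hn
  simp
  linarith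

lemma hookFactor_ne_zero (r : ℕ) {n : ℤ} (hn : 1 ≤ n) : hookFactor r n ≠ 0 :=
  mul_ne_zero (signHom_ne_zero _) (bracket_zero_ne_zero r hn)

lemma hookFactor_sub {r : ℕ} (hr : 0 < r) (l l' : ℕ) :
    hookFactor r ((l : ℤ) - l') =
      signHom ((-1) ^ (l / r) * (-1) ^ (l' / r)) * pairFactor r l l' := by
  have hr' : (0 : ℤ) < r := by exact_mod_cast hr
  have h1 := Nat.mod_lt l hr
  have h2 := Nat.mod_lt l' hr
  have e1 := Nat.mod_add_div l r
  have e2 := Nat.mod_add_div l' r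
  have hpow : ((-1 : ℤˣ) ^ (l / r) * (-1) ^ (l' / r)) =
      (-1) ^ (((l / r : ℕ) : ℤ) - ((l' / r : ℕ) : ℤ)) := by
    rw [zpow_sub, zpow_natCast, zpow_natCast, Int.units_inv_eq_self]
  have hdiff : (l : ℤ) - l' = ((l % r : ℕ) : ℤ) - ((l' % r : ℕ) : ℤ) +
      (((l / r : ℕ) : ℤ) - ((l' / r : ℕ) : ℤ)) * r := by
    have e1' : (l : ℤ) = ((l % r : ℕ) : ℤ) + r * ((l / r : ℕ) : ℤ) := by exact_mod_cast e1.symm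
    have e2' : (l' : ℤ) = ((l' % r : ℕ) : ℤ) + r * ((l' / r : ℕ) : ℤ) := by
      exact_mod_cast e2.symm
    linear_combination e1' - e2'
  have hfloor : ((l : ℤ) - l') / (r : ℤ) = (((l % r : ℕ) : ℤ) - ((l' % r : ℕ) : ℤ)) / (r : ℤ) +
      (((l / r : ℕ) : ℤ) - ((l' / r : ℕ) : ℤ)) := by
    rw [hdiff, Int.add_mul_ediv_right _ _ hr'.ne']
  have hmod : ((l : ℤ) - l') ≡ ((0 : ℕ) : ℤ) [ZMOD (r : ℤ)] ↔ l % r = l' % r := by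
    rw [Nat.cast_zero, Int.modEq_zero_iff_dvd, ← Nat.modEq_iff_dvd, Nat.ModEq, eq_comm]
  rw [hookFactor, hpow, hfloor, zpow_add, map_mul, bracket, pairFactor]
  simp only [hmod]
  rcases lt_trichotomy (l % r) (l' % r) with h | h | h
  · have : (((l % r : ℕ) : ℤ) - ((l' % r : ℕ) : ℤ)) / (r : ℤ) = -1 := by
      rw [Int.ediv_eq_iff_of_pos hr']
      constructor <;> omega
    rw [this, if_neg h.ne, if_neg h.ne, if_pos h]
    simp [signHom]
  · rw [h, sub_self, Int.zero_ediv, if_pos rfl, if_pos rfl]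
    push_cast
    simp
  · have : (((l % r : ℕ) : ℤ) - ((l' % r : ℕ) : ℤ)) / (r : ℤ) = 0 :=
      Int.ediv_eq_zero_of_lt (by omega) (by omega)
    rw [this, if_neg h.ne', if_neg h.ne', if_neg (by omega)]
    simp

lemma prod_hookFactor_sub {r N : ℕ} (hr : 0 < r) (l : Fin N → ℕ) :
    ∏ i, ∏ j ∈ Ioi i, hookFactor r ((l i : ℤ) - l j) =
      signHom (∏ i, ((-1) ^ (l i / r)) ^ (N - 1)) *
        ∏ i, ∏ j ∈ Ioi i, pairFactor r (l i) (l j) := by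
  rw [← prod_pairs fun i => (-1 : ℤˣ) ^ (l i / r), map_prod, ← prod_mul_distrib]
  refine prod_congr rfl fun i _ => ?_
  rw [map_prod, ← prod_mul_distrib]
  exact prod_congr rfl fun j _ => hookFactor_sub hr _ _

/-- The product of all factors attached to a set of beta numbers whose residues are matched
with `0, …, N - 1`. -/
lemma prod_floorSign_hookFactor {r N : ℕ} (hr : 0 < r) {l : Fin N → ℕ}
    (hl : ∃ σ : Equiv.Perm (Fin N), ∀ i, l (σ i) % r = (i : ℕ) % r) :
    signHom (∏ i, floorSign r N (l i)) * ∏ i, ∏ j ∈ Ioi i, hookFactor r ((l i : ℤ) - l j) =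
      signHom ((∏ i : Fin N, floorSign r N ((i : ℕ) % r)) * (-1) ^ (∑ i, l i / r)) *
        ∏ i, ∏ j ∈ Ioi i, pairFactor r (l i) (l j) := by
  obtain ⟨σ, hσ⟩ := hl
  rw [prod_hookFactor_sub hr, ← mul_assoc, ← map_mul]
  congr 2
  have h1 : ∏ i, floorSign r N (l i % r) = ∏ i : Fin N, floorSign r N ((i : ℕ) % r) := by
    rw [← Equiv.prod_comp σ]
    simp_rw [hσ]
  rw [← h1, ← prod_pow_eq_pow_sum, ← prod_mul_distrib, ← prod_mul_distrib]
  refine prod_congr rfl fun i _ => ?_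
  rw [floorSign_eq hr, mul_assoc]
  congr 1
  have hN := i.pos
  rw [← pow_mul, ← pow_add, mul_comm (l i / r), ← add_mul,
    show N + (N - 1) = 2 * (N - 1) + 1 by omega, add_mul, one_mul, pow_add, mul_assoc, pow_mul]
  simp

/-! ### The product over the cells -/

/-- The factor contributed by a cell of content `n - N`. -/
def contentFactor (r a N : ℕ) (u v : ℂ) (n : ℤ) : ℂ :=
  signHom ((-1) ^ ((n - N) / (r : ℤ))) * (bracket r 0 n 0 *
    (bracket r a n ((r : ℂ) * u) / bracket r a ((N : ℤ) + n) ((r : ℂ) * u + (r : ℂ) * v)))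

lemma prod_contentFactor (r a N : ℕ) (u v : ℂ) (m : ℕ) :
    ∏ n ∈ Icc 1 m, contentFactor r a N u v n =
      signHom (floorSign r N m) * bracketRatio r a N u v m *
        ∏ n ∈ Icc 1 m, hookFactor r n := by
  rw [floorSign, map_prod, bracketRatio, ← prod_mul_distrib, ← prod_mul_distrib]
  refine prod_congr rfl fun n _ => ?_
  rw [contentFactor, hookFactor, zpow_add, map_mul]
  linear_combination (-signHom ((-1) ^ (((n : ℤ) - N) / (r : ℤ))) * (bracket r 0 n 0 *
    (bracket r a n ((r : ℂ) * u) / bracket r a ((N : ℤ) + n) ((r : ℂ) * u + (r : ℂ) * v)))) *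
    signHom_mul_self ((-1) ^ ((n : ℤ) / (r : ℤ)))

lemma prod_range_Ioo {M : Type*} [CommMonoid M] (N : ℕ) (F : ℕ → ℕ → M) :
    ∏ i ∈ range N, ∏ k ∈ Ioo i N, F i k = ∏ i : Fin N, ∏ j ∈ Ioi i, F i j := by
  rw [prod_range]
  refine prod_congr rfl fun i _ => ?_
  rw [← Fin.map_valEmbedding_Ioi, prod_map]
  rfl

lemma signed_prod_cells {r a N : ℕ} {u v : ℂ} (lam : YoungDiagram) :
    signHom (∏ x ∈ lam.cells, (-1 : ℤˣ) ^ (content x / (r : ℤ) + hookLength lam x / (r : ℤ))) *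
      ∏ x ∈ lam.cells,
        (bracket r 0 ((N : ℤ) + content x) 0 *
          bracket r a ((N : ℤ) + content x) ((r : ℂ) * u)) /
        (bracket r 0 (hookLength lam x) 0 *
          bracket r a (2 * (N : ℤ) + content x) ((r : ℂ) * u + (r : ℂ) * v)) =
      (∏ x ∈ lam.cells, contentFactor r a N u v ((N : ℤ) + content x)) /
        ∏ x ∈ lam.cells, hookFactor r (hookLength lam x) := by
  rw [map_prod, ← prod_mul_distrib, ← prod_div_distrib]
  refine prod_congr rfl fun x _ => ?_
  rw [contentFactor, hookFactor, zpow_add, map_mul, add_sub_cancel_left,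
    show (N : ℤ) + ((N : ℤ) + content x) = 2 * (N : ℤ) + content x by ring,
    div_eq_mul_inv _ (_ * bracket r 0 (hookLength lam x) 0), mul_inv, signHom_inv]
  simp only [div_eq_mul_inv, mul_inv]
  ring

lemma card_eq_sub_sum {N : ℕ} {lam : YoungDiagram} (hN : lam.colLen 0 ≤ N) :
    ∑ i : Fin N, beta N lam i = lam.card + ∑ i : Fin N, (N - 1 - (i : ℕ)) := by
  rw [YoungDiagram.card, card_eq_sum_ones, sum_cells hN, ← sum_range (fun i => beta N lam i),
    ← sum_range (fun i => N - 1 - i), ← sum_add_distrib]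
  refine sum_congr rfl fun i _ => ?_
  simp [beta, add_comm]

lemma card_div_add {r N : ℕ} (hr : 0 < r) {lam : YoungDiagram} (hN : lam.colLen 0 ≤ N)
    {σ τ : Equiv.Perm (Fin N)} (hσ : ∀ i, beta N lam (σ i) % r = (i : ℕ) % r)
    (hτ : ∀ i, (N - 1 - (τ i : ℕ)) % r = (i : ℕ) % r) :
    lam.card / r + ∑ i : Fin N, (N - 1 - (i : ℕ)) / r = ∑ i : Fin N, beta N lam i / r := by
  have h := card_eq_sub_sum hN
  have split : ∀ f : Fin N → ℕ, ∑ i, f i = ∑ i, f i % r + r * ∑ i, f i / r := fun f => by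
    rw [mul_sum, ← sum_add_distrib]
    exact sum_congr rfl fun i _ => (Nat.mod_add_div _ _).symm
  have e1 : ∑ i : Fin N, beta N lam i % r = ∑ i : Fin N, (i : ℕ) % r := by
    rw [← Equiv.sum_comp σ]; simp_rw [hσ]
  have e2 : ∑ i : Fin N, (N - 1 - (i : ℕ)) % r = ∑ i : Fin N, (i : ℕ) % r := by
    rw [← Equiv.sum_comp τ]; simp_rw [hτ]
  rw [split fun i => beta N lam i, split fun i : Fin N => N - 1 - (i : ℕ), e1, e2] at h
  rw [← Nat.add_mul_div_left _ _ hr]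
  exact Nat.div_eq_of_eq_mul_right hr (by omega)

/-- The signed product over the cells in terms of beta numbers. -/
theorem signed_cell_product {r a N : ℕ} (hr : 0 < r) {u v : ℂ} {lam : YoungDiagram}
    (hN : lam.colLen 0 ≤ N)
    (hA : ∀ i : Fin N, bracketRatio r a N u v (N - 1 - (i : ℕ)) ≠ 0)
    (hl : ∃ σ : Equiv.Perm (Fin N), ∀ i, beta N lam (σ i) % r = (i : ℕ) % r)
    (hk : ∃ σ : Equiv.Perm (Fin N), ∀ i, (N - 1 - (σ i : ℕ)) % r = (i : ℕ) % r) :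
    signHom ((-1) ^ (lam.card / r) *
        ∏ x ∈ lam.cells, (-1 : ℤˣ) ^ (content x / (r : ℤ) + hookLength lam x / (r : ℤ))) *
      ∏ x ∈ lam.cells,
        (bracket r 0 ((N : ℤ) + content x) 0 *
          bracket r a ((N : ℤ) + content x) ((r : ℂ) * u)) /
        (bracket r 0 (hookLength lam x) 0 *
          bracket r a (2 * (N : ℤ) + content x) ((r : ℂ) * u + (r : ℂ) * v)) =
      ((∏ i : Fin N, bracketRatio r a N u v (beta N lam i)) *
          ∏ i : Fin N, ∏ j ∈ Ioi i, pairFactor r (beta N lam i) (beta N lam j)) /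
        ((∏ i : Fin N, bracketRatio r a N u v (N - 1 - (i : ℕ))) *
          ∏ i : Fin N, ∏ j ∈ Ioi i, pairFactor r (N - 1 - (i : ℕ)) (N - 1 - (j : ℕ))) := by
  have hHne : ∀ m : ℕ, ∏ n ∈ Icc 1 m, hookFactor r (n : ℤ) ≠ 0 := fun m =>
    prod_ne_zero_iff.2 fun n hn => hookFactor_ne_zero r (by exact_mod_cast (mem_Icc.1 hn).1)
  have hbot : (⊥ : YoungDiagram).colLen 0 ≤ N := by rw [colLen_bot]; exact Nat.zero_le _
  have hooks : ∀ mu : YoungDiagram, mu.colLen 0 ≤ N →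
      (∏ x ∈ mu.cells, hookFactor r (hookLength mu x)) *
        ∏ i : Fin N, ∏ j ∈ Ioi i, hookFactor r ((beta N mu i : ℤ) - beta N mu j) =
      ∏ i : Fin N, ∏ n ∈ Icc 1 (beta N mu i), hookFactor r (n : ℤ) := by
    intro mu hmu
    rw [prod_cells hmu, ← prod_range_Ioo N fun i j => hookFactor r ((beta N mu i : ℤ) - beta N mu j),
      ← prod_mul_distrib, ← prod_range fun i => ∏ n ∈ Icc 1 (beta N mu i), hookFactor r (n : ℤ)]
    exact prod_congr rfl fun i hi => prod_hooks_row hmu (mem_range.1 hi) _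
  have hcont : (∏ x ∈ lam.cells, contentFactor r a N u v ((N : ℤ) + content x)) *
      ∏ i : Fin N, ∏ n ∈ Icc 1 (N - 1 - (i : ℕ)), contentFactor r a N u v (n : ℤ) =
      ∏ i : Fin N, ∏ n ∈ Icc 1 (beta N lam i), contentFactor r a N u v (n : ℤ) := by
    rw [prod_cells hN, ← prod_range fun i => ∏ n ∈ Icc 1 (N - 1 - i), contentFactor r a N u v n,
      ← prod_mul_distrib, ← prod_range fun i => ∏ n ∈ Icc 1 (beta N lam i),
        contentFactor r a N u v n]
    exact prod_congr rfl fun i hi => prod_contents_row (mem_range.1 hi) _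
  have h1 := hooks lam hN
  have h2 := hooks ⊥ hbot
  simp only [YoungDiagram.cells_bot, prod_empty, one_mul, beta_bot] at h2
  simp only [prod_contentFactor, prod_mul_distrib, ← map_prod] at hcont
  have s1 := prod_floorSign_hookFactor (l := fun i : Fin N => beta N lam i) hr hl
  have s2 := prod_floorSign_hookFactor (l := fun i : Fin N => N - 1 - (i : ℕ)) hr hk
  obtain ⟨σ, hσ⟩ := hl
  obtain ⟨τ, hτ⟩ := hk
  have hP := card_div_add hr hN hσ hτ
  rw [map_mul, mul_assoc, signed_prod_cells]
  rw [← hP, pow_add, map_mul, map_mul] at s1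
  rw [map_mul] at s2
  have hH0 : (∏ i : Fin N, ∏ n ∈ Icc 1 (N - 1 - (i : ℕ)), hookFactor r (n : ℤ)) ≠ 0 :=
    prod_ne_zero_iff.2 fun i _ => hHne _
  have hH1 : (∏ i : Fin N, ∏ n ∈ Icc 1 (beta N lam i), hookFactor r (n : ℤ)) ≠ 0 :=
    prod_ne_zero_iff.2 fun i _ => hHne _
  have hA0 : (∏ i : Fin N, bracketRatio r a N u v (N - 1 - (i : ℕ))) ≠ 0 :=
    prod_ne_zero_iff.2 fun i _ => hA i
  rw [← h1] at hH1 hcont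
  rw [← h2] at hH0 hcont
  have hx := left_ne_zero_of_mul hH1
  have hy := right_ne_zero_of_mul hH1
  set X := ∏ x ∈ lam.cells, contentFactor r a N u v ((N : ℤ) + content x)
  set Y := ∏ x ∈ lam.cells, hookFactor r (hookLength lam x)
  set HL := ∏ i : Fin N, ∏ j ∈ Ioi i, hookFactor r ((beta N lam i : ℤ) - beta N lam j)
  set HK := ∏ i : Fin N, ∏ j ∈ Ioi i,
    hookFactor r (((N - 1 - (i : ℕ) : ℕ) : ℤ) - ((N - 1 - (j : ℕ) : ℕ) : ℤ))
  set PL := ∏ i : Fin N, ∏ j ∈ Ioi i, pairFactor r (beta N lam i) (beta N lam j)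
  set PK := ∏ i : Fin N, ∏ j ∈ Ioi i, pairFactor r (N - 1 - (i : ℕ)) (N - 1 - (j : ℕ))
  set AL := ∏ i : Fin N, bracketRatio r a N u v (beta N lam i)
  set AK := ∏ i : Fin N, bracketRatio r a N u v (N - 1 - (i : ℕ))
  set εL := signHom (∏ i : Fin N, floorSign r N (beta N lam i))
  set εK := signHom (∏ i : Fin N, floorSign r N (N - 1 - (i : ℕ)))
  set E := signHom (∏ i : Fin N, floorSign r N ((i : ℕ) % r)) with hE
  set t := signHom ((-1) ^ (lam.card / r)) with ht
  set q := signHom ((-1) ^ (∑ i : Fin N, (N - 1 - (i : ℕ)) / r)) with hq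
  have htt : t * t = 1 := signHom_mul_self _
  have hE0 : E ≠ 0 := signHom_ne_zero _
  have hq0 : q ≠ 0 := signHom_ne_zero _
  have hεK : εK ≠ 0 := signHom_ne_zero _
  have hPK : PK ≠ 0 := right_ne_zero_of_mul (s2 ▸ mul_ne_zero hεK hH0)
  rw [mul_div_assoc', div_eq_div_iff hx (mul_ne_zero hA0 hPK)]
  have key : E * q * HL * (t * X * (AK * PK)) = E * q * HL * (AL * PL * Y) := by
    linear_combination (-AK * X * HL * t) * s2 + t * HL * hcont + (AL * Y * HL * t) * s1 +
      (E * q * PL * HL * AL * Y) * htt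
  exact mul_left_cancel₀ (mul_ne_zero (mul_ne_zero hE0 hq0) hy) key

/-! ### The theorem -/

lemma exists_perm_rev_mod (r N : ℕ) :
    ∃ σ : Equiv.Perm (Fin N), ∀ i, (N - 1 - (σ i : ℕ)) % r = (i : ℕ) % r :=
  ⟨Fin.revPerm, fun i => by
    rw [Fin.revPerm_apply, Fin.val_rev]
    congr 1
    omega⟩

lemma pairFactor_ne_zero {r l l' : ℕ} (h : l ≠ l') : pairFactor r l l' ≠ 0 := by
  unfold pairFactor
  split_ifs
  · exact sub_ne_zero.2 (by exact_mod_cast h)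
  · exact neg_ne_zero.2 one_ne_zero
  · exact one_ne_zero

theorem partitionFunction_ne_zero_iff {r a N : ℕ} (hr : 0 < r) (ha : a < r) {u v : ℂ}
    (hu : -1 / (r : ℝ) < u.re) (hv : -1 < v.re) :
    partitionFunction r a N u v ≠ 0 ↔ N ≡ 0 [MOD r] ∨ N ≡ a [MOD r] := by
  rw [(one_converges_and_Z_eq (a := a) hr u v hu hv).2]
  constructor
  · intro h
    obtain ⟨σ, hσ⟩ := exists_perm_of_det_ne_zero hr ha hu hv
      (l := fun i : Fin N => N - 1 - (i : ℕ)) h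
    refine modEq_of_perm_partner hr ha (σ.trans Fin.revPerm) fun i => ?_
    rw [← hσ i, Equiv.trans_apply, Fin.revPerm_apply, Fin.val_rev]
    congr 1
    omega
  · intro hN
    obtain ⟨K, hK0, hK⟩ := exists_det_moment hr ha hN hu hv
    rw [hK (fun i : Fin N => N - 1 - (i : ℕ)) (exists_perm_rev_mod r N)]
    refine mul_ne_zero (mul_ne_zero hK0 (prod_ne_zero_iff.2 fun i _ =>
      bracketRatio_ne_zero hr ha hN i.pos hu hv _)) ?_
    refine prod_ne_zero_iff.2 fun i _ => prod_ne_zero_iff.2 fun j hj => pairFactor_ne_zero ?_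
    have : (i : ℕ) < j := Fin.lt_def.1 (mem_Ioi.1 hj)
    omega

theorem average_schur {r a N : ℕ} (hr : 0 < r) (ha : a < r) {u v : ℂ}
    (hu : -1 / (r : ℝ) < u.re) (hv : -1 < v.re) {lam : YoungDiagram} (hlam : lam.colLen 0 ≤ N)
    (hZ : partitionFunction r a N u v ≠ 0) :
    average r a N u v (schur N lam) =
      (rSignature r lam : ℂ) *
        ∏ x ∈ lam.cells,
          (bracket r 0 ((N : ℤ) + content x) 0 *
            bracket r a ((N : ℤ) + content x) ((r : ℂ) * u)) /
          (bracket r 0 (hookLength lam x) 0 *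
            bracket r a (2 * (N : ℤ) + content x) ((r : ℂ) * u + (r : ℂ) * v)) := by
  have hN := (partitionFunction_ne_zero_iff hr ha hu hv).1 hZ
  have hS := (schur_converges_and_Z_eq (a := a) (N := N) hr u v hu hv lam).2
  have h1 := (one_converges_and_Z_eq (a := a) (N := N) hr u v hu hv).2
  rw [average, hS]
  by_cases hcore : IsRCore r lam ⊥
  · obtain ⟨K, hK0, hK⟩ := exists_det_moment hr ha hN hu hv
    have hl := (isRCore_bot_iff hr hlam).1 hcore
    have hsig : (rSignature r lam : ℂ) = signHom ((-1) ^ (lam.card / r) *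
        ∏ x ∈ lam.cells, (-1 : ℤˣ) ^ (content x / (r : ℤ) + hookLength lam x / (r : ℤ))) := by
      rw [rSignature, if_pos hcore]
      rfl
    rw [hsig, signed_cell_product hr hlam
      (fun i => bracketRatio_ne_zero hr ha hN i.pos hu hv _) hl (exists_perm_rev_mod r N), h1,
      hK (fun i : Fin N => N - 1 - (i : ℕ)) (exists_perm_rev_mod r N),
      hK (fun i : Fin N => N - 1 - (i : ℕ) + lam.rowLen i) hl, mul_assoc K, mul_assoc K,
      mul_div_mul_left _ _ hK0]
    rfl
  · have hdet : Matrix.det (Matrix.of fun i j : Fin N =>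
        moment r a u v ((N - 1 - (i : ℕ) + lam.rowLen i) + (N - 1 - (j : ℕ)))) = 0 := by
      by_contra hne
      obtain ⟨σ, hσ⟩ := exists_perm_of_det_ne_zero hr ha hu hv
        (l := fun i : Fin N => N - 1 - (i : ℕ) + lam.rowLen i) hne
      refine hcore ((isRCore_bot_iff hr hlam).2 ⟨(partnerPerm hr ha hN).trans σ, fun i => ?_⟩)
      have hi := Nat.mod_lt (i : ℕ) hr
      have := hσ (partnerPerm hr ha hN i)
      rw [partnerPerm_val, add_mul_mod (partner_lt ha hi), partner_partner ha hi] at this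
      exact this
    rw [hdet, zero_div, rSignature, if_neg hcore]
    simp

end Average

end RFold

end

theorem mainTheorem8 (r a N : ℕ) (hr : 0 < r) (ha : a < r) (u v : ℂ)
    (hu : -1 / (r : ℝ) < u.re) (hv : -1 < v.re) :
    RFold.Converges r N u v (fun _ => 1) ∧
    (RFold.partitionFunction r a N u v ≠ 0 ↔ N ≡ 0 [MOD r] ∨ N ≡ a [MOD r]) ∧
    ∀ lam : YoungDiagram, lam.colLen 0 ≤ N →
      RFold.Converges r N u v (RFold.schur N lam) ∧
      (RFold.partitionFunction r a N u v ≠ 0 →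
        RFold.average r a N u v (RFold.schur N lam) =
          (RFold.rSignature r lam : ℂ) *
            ∏ x ∈ lam.cells,
              (RFold.bracket r 0 ((N : ℤ) + RFold.content x) 0 *
                RFold.bracket r a ((N : ℤ) + RFold.content x) ((r : ℂ) * u)) /
              (RFold.bracket r 0 (RFold.hookLength lam x) 0 *
                RFold.bracket r a (2 * (N : ℤ) + RFold.content x)
                  ((r : ℂ) * u + (r : ℂ) * v))) :=
  ⟨(RFold.one_converges_and_Z_eq (a := a) hr u v hu hv).1,
    RFold.partitionFunction_ne_zero_iff hr ha hu hv, fun lam hlam =>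
    ⟨(RFold.schur_converges_and_Z_eq (a := a) hr u v hu hv lam).1,
      RFold.average_schur hr ha hu hv hlam⟩⟩
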